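/- Let $a\le 0$, $\sigma>0$, $0<\gamma<1$. Let $x_1,x_2,\dots$ be independent solutions of the scalar Langevin equation $dx=ax\,dt+\sigma\,dw$, $x(0)=0$, where $w$ is a standard Wiener process, and let $$V_\infty=\mathbb E\int_0^\infty\gamma^t x_i(t)^2\,dt .$$ For a step size $h>0$ and integers $N,M\ge1$ put $T=Nh$ (estimation horizon), $B=MN$ (data budget), $$\hat V_M(h)=\frac1M\sum_{i=1}^M\sum_{k=0}^{N-1}\gamma^{kh}\,h\,x_i(kh)^2,\qquad \mathrm{MSE}_\infty(h,B,T)=\mathbb E\big[(\hat V_M(h)-V_\infty)^2\big],\qquad C(a,\gamma)=\frac1{\log\gamma\,(a+\log\gamma)(2a+\log\gamma)^2}.$$ These expectations are finite. Along every family of triples $(h,N,M)$ with $h\to0$ and $\gamma^T=o(h^4)$, $$\mathrm{MSE}_\infty(h,B,T)=\sigma^4\,T\,C(a,\gamma)\cdot\frac1{hB}+\frac{\sigma^4}{144}\,h^4+\mathcal O(h^5)+\mathcal O\!\left(\frac{hT}{B}\right),$$ with implied constants depending only on $a,\gamma,\sigma$. In particular, if moreover $hT=\mathcal O(1)$, then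 $$\mathrm{MSE}_\infty(h,B,T)=\sigma^4\,T\,C(a,\gamma)\cdot\frac1{hB}+\frac{\sigma^4}{144}\,h^4+\mathcal O(h^5)+\mathcal O(B^{-1}).$$ Consequently $h^*=h^*(B,T)=\big(36\,T\,C(a,\gamma)/B\big)^{1/5}$ is the optimal step size in the following sense. For all real $T,B>0$, $h^*$ is the unique minimiser over $h>0$ of the leading part $F_{T,B}(h)=\sigma^4TC(a,\gamma)/(hB)+\sigma^4h^4/144$. Moreover, along every family of triples with $h\to0$ and $\gamma^T=o(h^4)$, for each $\varepsilon>0$ eventually $\mathrm{MSE}_\infty(h,B,T)\ge(1-\varepsilon)F_{T,B}(h^*)$, and $\mathrm{MSE}_\infty(h,B,T)\sim F_{T,B}(h^*)$ if and only if $h\sim h^*$. -/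

import Mathlib

open MeasureTheory ProbabilityTheory Filter Topology Asymptotics
open scoped NNReal

noncomputable section

/-- `x` solves the scalar Langevin equation `dx = a x dt + σ dw`, `x(0) = 0`, driven by the standard
Wiener process `w`. As the noise is additive, the equation is the integral equation
`x(t) = a ∫₀ᵗ x(s) ds + σ w(t)` for almost every path. -/
structure IsLangevinSolution {Ω : Type*} [MeasurableSpace Ω] (μ : Measure Ω) (a σ : ℝ)
    (w x : ℝ≥0 → Ω → ℝ) : Prop where
  brownian : IsBrownianReal w μ
  continuous_paths : ∀ᵐ ω ∂μ, Continuous fun t : ℝ≥0 => x t ω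
  integral_eq : ∀ᵐ ω ∂μ, ∀ t : ℝ≥0,
    x t ω = a * (∫ s in (0 : ℝ)..t, x s.toNNReal ω) + σ * w t ω

/-- The infinite-horizon discounted cost `J_∞ = ∫₀^∞ γᵗ x(t)² dt` of a trajectory. -/
def discountedCost {Ω : Type*} (γ : ℝ) (x : ℝ≥0 → Ω → ℝ) (ω : Ω) : ℝ :=
  ∫ t in Set.Ioi (0 : ℝ), γ ^ t * x t.toNNReal ω ^ 2

/-- The expected cost `V_∞ = E[J_∞]`. -/
def expectedCost {Ω : Type*} [MeasurableSpace Ω] (μ : Measure Ω) (γ : ℝ)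
    (x : ℝ≥0 → Ω → ℝ) : ℝ :=
  ∫ ω, discountedCost γ x ω ∂μ

/-- The Riemann sum estimator `Ĵ(h) = ∑_{k < N} γ^{kh} h x(kh)²` from one trajectory. -/
def riemannEstimator {Ω : Type*} (γ h : ℝ) (N : ℕ) (x : ℝ≥0 → Ω → ℝ) (ω : Ω) : ℝ :=
  ∑ k ∈ Finset.range N, γ ^ ((k : ℝ) * h) * h * x ((k : ℝ) * h).toNNReal ω ^ 2

/-- The Monte-Carlo estimator `V̂_M(h)`, the average of the Riemann sum estimators of the first `M`
trajectories. -/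
def monteCarloEstimator {Ω : Type*} (γ h : ℝ) (N M : ℕ) (x : ℕ → ℝ≥0 → Ω → ℝ) (ω : Ω) : ℝ :=
  (1 / (M : ℝ)) * ∑ i ∈ Finset.range M, riemannEstimator γ h N (x i) ω

/-- The infinite-horizon mean-squared error `E[(V̂_M(h) - V_∞)²]`, with step size `h`, `N` sample
points per trajectory and `M` trajectories. -/
def mseInfinite {Ω : Type*} [MeasurableSpace Ω] (μ : Measure Ω) (γ h : ℝ) (N M : ℕ)
    (x : ℕ → ℝ≥0 → Ω → ℝ) : ℝ :=
  ∫ ω, (monteCarloEstimator γ h N M x ω - expectedCost μ γ (x 0)) ^ 2 ∂μ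

/-- The constant `C(a, γ) = 1 / (log γ (a + log γ) (2a + log γ)²)`. -/
def varianceConst (a γ : ℝ) : ℝ :=
  1 / (Real.log γ * (a + Real.log γ) * (2 * a + Real.log γ) ^ 2)

/-- The leading part `σ⁴ T C(a, γ) / (h B) + σ⁴ h⁴ / 144` of the mean-squared error, as a function
of the estimation horizon `T`, the data budget `B` and the step size `h`. -/
def leadingMSE (a γ σ T B h : ℝ) : ℝ :=
  σ ^ 4 * T * varianceConst a γ * (1 / (h * B)) + σ ^ 4 / 144 * h ^ 4

/-- The optimal step size `h* = (36 T C(a, γ) / B)^{1/5}`. -/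
def optimalStep (a γ T B : ℝ) : ℝ :=
  (36 * T * varianceConst a γ / B) ^ ((1 : ℝ) / 5)

end

/-!
The proof reduces the mean-squared error to two explicit finite sums and expands these for small
step sizes.

*Law of the solution.* The Euler scheme `Z_{k+1} = (1 + aδ) Z_k + σ Δw` converges to the solution of
the Langevin equation path by path (`tendsto_eulerValue`). It is a sum of independent centered
Gaussian variables with converging variances, so `x(t)` is centered Gaussian with variance
`v(t) = σ² ∫₀ᵗ e^{2as} ds` (`IsLangevinSolution.hasLaw`). The process `u ↦ x(s+u) - e^{au} x(s)`
solves the equation driven by the shifted Wiener process, and is independent of `x(s)` because both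
are functionals of independent pieces of the Wiener process (`IsLangevinSolution.shift`,
`IsLangevinSolution.indepFun_shift`). Hence `cov(x(s)², x(s+u)²) = 2 e^{2au} v(s)²`.

*Reduction.* By independence of the trajectories, the mean-squared error is
`Var(Ĵ) / M + (E Ĵ - V_∞)²` (`mseInfinite_eq`), where `V_∞ = σ² / (L (L + 2a))` with `L = log γ`
(`IsLangevinSolution.expectedCost_eq`), and the mean and the variance of the Riemann sum `Ĵ` are
discounted sums in `g = γ^h`, `q = e^{2ah}` and `w_k = 1 + q + ⋯ + q^{k-1}`. Both sums telescope
(`discountedSum_eq`, `discountedSqSum_eq`), since `w_{k+1} = q w_k + 1`; this treats `a = 0` and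
`a < 0` alike. The truncation errors are at most a constant times `(1 + T)³ γ^T`, which is `O(h³)`
when `γ^T ≤ h⁴`.

*Expansion.* Written through `sinhc x = sinh x / x`, the untruncated mean and variance are even in
`h`: the mean is `V_∞ sinhc(ah) / (sinhc(Lh/2) sinhc((L/2+a)h)) = V_∞ - σ² h² / 12 + O(h⁴)` and the
variance is `σ⁴ C(a, γ) (1 + O(h²))` (`riemannMean_limit_eq`, `riemannVar_limit_eq`). Since
`T / (h B) = 1 / M` and `h T / B = h² / M`, this is the claimed expansion
(`exists_mse_expansion`).

*Optimality.* The remainders are `O(h)` relative to the leading part `F`, so the mean-squared error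
is equivalent to `F(h)`. With `ρ = h / h*` one has `F(h) / F(h*) = (4/ρ + ρ⁴) / 5`, which is at
least `1 + 3 (ρ - 1)² / 5`; so `F(h) ~ F(h*)` exactly when `h ~ h*` (`isEquivalent_leadingMSE_iff`).
-/

/-! ### The variance function -/

/-- The variance `σ² ∫₀ᵗ e^{2as} ds` at time `t` of the solution of the Langevin equation started
at zero. -/
noncomputable def langevinVar (a σ t : ℝ) : ℝ := σ ^ 2 * ∫ s in (0 : ℝ)..t, Real.exp (2 * a * s)

lemma langevinVar_zero (a σ : ℝ) : langevinVar a σ 0 = 0 := by simp [langevinVar]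

lemma hasDerivAt_langevinVar (a σ t : ℝ) :
    HasDerivAt (langevinVar a σ) (σ ^ 2 * Real.exp (2 * a * t)) t := by
  have hc : Continuous fun s : ℝ => Real.exp (2 * a * s) := by fun_prop
  exact (intervalIntegral.integral_hasDerivAt_right (hc.intervalIntegrable _ _)
    (hc.stronglyMeasurableAtFilter _ _) hc.continuousAt).const_mul _

lemma mul_integral_exp (a t : ℝ) :
    2 * a * ∫ s in (0 : ℝ)..t, Real.exp (2 * a * s) = Real.exp (2 * a * t) - 1 := by
  rw [← intervalIntegral.integral_const_mul]
  have hd : ∀ s ∈ Set.uIcc 0 t,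
      HasDerivAt (fun s : ℝ => Real.exp (2 * a * s)) (2 * a * Real.exp (2 * a * s)) s := by
    intro s _
    have := ((hasDerivAt_id s).const_mul (2 * a)).exp
    simp only [id, mul_one] at this
    exact this.congr_deriv (mul_comm _ _)
  rw [intervalIntegral.integral_eq_sub_of_hasDerivAt hd
    ((by fun_prop : Continuous fun s : ℝ => 2 * a * Real.exp (2 * a * s)).intervalIntegrable _ _)]
  simp

lemma mul_langevinVar (a σ t : ℝ) :
    2 * a * langevinVar a σ t = σ ^ 2 * (Real.exp (2 * a * t) - 1) := by
  rw [← mul_integral_exp, langevinVar]; ring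

lemma langevinVar_nonneg (a σ : ℝ) {t : ℝ} (ht : 0 ≤ t) : 0 ≤ langevinVar a σ t :=
  mul_nonneg (sq_nonneg _)
    (intervalIntegral.integral_nonneg ht fun _ _ => (Real.exp_pos _).le)

lemma langevinVar_le {a : ℝ} (ha : a ≤ 0) (σ : ℝ) {t : ℝ} (ht : 0 ≤ t) :
    langevinVar a σ t ≤ σ ^ 2 * t := by
  refine mul_le_mul_of_nonneg_left ?_ (sq_nonneg _)
  calc ∫ s in (0 : ℝ)..t, Real.exp (2 * a * s) ≤ ∫ _ in (0 : ℝ)..t, (1 : ℝ) := by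
        refine intervalIntegral.integral_mono_on ht
          ((by fun_prop : Continuous fun s : ℝ => Real.exp (2 * a * s)).intervalIntegrable _ _)
          (by simp) fun s hs => ?_
        rw [Real.exp_le_one_iff]
        nlinarith [hs.1]
    _ = t := by simp

lemma langevinVar_add (a σ s t : ℝ) :
    langevinVar a σ (s + t) = Real.exp (2 * a * s) * langevinVar a σ t + langevinVar a σ s := by
  have hc : Continuous fun s : ℝ => Real.exp (2 * a * s) := by fun_prop
  have h := intervalIntegral.integral_add_adjacent_intervals
    (hc.intervalIntegrable (μ := volume) 0 s) (hc.intervalIntegrable s (s + t))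
  have h2 : ∫ r in s..(s + t), Real.exp (2 * a * r)
      = Real.exp (2 * a * s) * ∫ r in (0 : ℝ)..t, Real.exp (2 * a * r) := by
    rw [← intervalIntegral.integral_const_mul]
    have := intervalIntegral.integral_comp_add_left (a := 0) (b := t)
      (fun r => Real.exp (2 * a * r)) s
    rw [add_zero] at this
    rw [← this]
    refine intervalIntegral.integral_congr fun r _ => ?_
    simp only [← Real.exp_add]
    ring_nf
  rw [langevinVar, ← h, h2, langevinVar, langevinVar]
  ring

/-! ### The Euler scheme -/

/-- The Euler scheme `Z₀ = 0`, `Z_{k+1} = ρ Z_k + σ (f (k+1) - f k)` driven by the samples `f`. For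
`ρ = 1 + a δ` and samples of `w` on a grid of mesh `δ` it discretises `dx = a x dt + σ dw`. -/
noncomputable def eulerScheme (ρ σ : ℝ) (f : ℕ → ℝ) : ℕ → ℝ
  | 0 => 0
  | k + 1 => ρ * eulerScheme ρ σ f k + σ * (f (k + 1) - f k)

lemma eulerScheme_eq_sum (ρ σ : ℝ) (f : ℕ → ℝ) (n : ℕ) :
    eulerScheme ρ σ f n = ∑ i ∈ Finset.range n, ρ ^ (n - 1 - i) * σ * (f (i + 1) - f i) := by
  induction n with
  | zero => simp [eulerScheme]
  | succ n ih =>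
    rw [eulerScheme, ih, Finset.sum_range_succ, Finset.mul_sum]
    congr 1
    · refine Finset.sum_congr rfl fun i hi => ?_
      have := Finset.mem_range.1 hi
      rw [show n + 1 - 1 - i = (n - 1 - i) + 1 by omega, pow_succ]
      ring
    · simp

lemma eulerScheme_congr {ρ σ : ℝ} {f g : ℕ → ℝ} {n : ℕ} (h : ∀ k ≤ n, f k = g k) :
    eulerScheme ρ σ f n = eulerScheme ρ σ g n := by
  induction n with
  | zero => rfl
  | succ n ih =>
    rw [eulerScheme, eulerScheme, ih fun k hk => h k (by omega), h (n + 1) le_rfl,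
      h n (by omega)]

/-- The value at time `t` of the Euler scheme with `n` steps driven by the path `p`. -/
noncomputable def eulerValue (a σ : ℝ) (t : ℝ≥0) (n : ℕ) (p : ℝ≥0 → ℝ) : ℝ :=
  eulerScheme (1 + a * (t / n)) σ (fun k => p (k * (t / n))) n

lemma measurable_eulerValue (a σ : ℝ) (t : ℝ≥0) (n : ℕ) : Measurable (eulerValue a σ t n) := by
  unfold eulerValue
  simp only [eulerScheme_eq_sum]
  fun_prop

/-- The Euler scheme converges to the solution of the Langevin equation, path by path: one step
multiplies the error by `1 + a δ ∈ [0, 1]` and adds at most `|a| δ` times the modulus of continuity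
of the solution. -/
lemma tendsto_eulerValue {a σ : ℝ} (ha : a ≤ 0) {w x : ℝ≥0 → ℝ} (hx : Continuous x) (hw : w 0 = 0)
    (h : ∀ t : ℝ≥0, x t = a * (∫ s in (0 : ℝ)..t, x s.toNNReal) + σ * w t) (t : ℝ≥0) :
    Tendsto (fun n => eulerValue a σ t n w) atTop (𝓝 (x t)) := by
  rw [Metric.tendsto_atTop]
  intro ε hε
  set ε' : ℝ := ε / (-a * t + 1) with hε'
  have hden : 0 < -a * t + 1 := by nlinarith [NNReal.coe_nonneg t]
  have hε'0 : 0 < ε' := div_pos hε hden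
  have huc := (isCompact_Icc (a := (0 : ℝ≥0)) (b := t)).uniformContinuousOn_of_continuous
    hx.continuousOn
  obtain ⟨η, hη, hmod⟩ := Metric.uniformContinuousOn_iff.1 huc ε' hε'0
  obtain ⟨n₀, hn₀⟩ := exists_nat_gt (max (t / η) (-a * t))
  refine ⟨n₀ + 1, fun n hn => ?_⟩
  have hn0 : (0 : ℝ) < n := by exact_mod_cast (by omega : 0 < n)
  have hnn : (n₀ : ℝ) ≤ n := by exact_mod_cast (by omega : n₀ ≤ n)
  have hδη : (t / n : ℝ) < η := by
    rw [div_lt_iff₀ hn0]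
    have := (div_lt_iff₀ hη).1 (((le_max_left _ _).trans_lt hn₀).trans_le hnn)
    linarith
  have haδ : 0 ≤ 1 + a * (t / n) := by
    have : -a * t < n := ((le_max_right _ _).trans_lt hn₀).trans_le hnn
    have : -a * t / n < 1 := (div_lt_one hn0).2 this
    have : a * (t / n) = -(-a * t / n) := by ring
    linarith
  have haδ' : 1 + a * (t / n : ℝ) ≤ 1 := by
    have : (0 : ℝ) ≤ t / n := by positivity
    nlinarith
  set δ : ℝ≥0 := t / n with hδ
  have hδr : (δ : ℝ) = t / n := by simp [hδ]
  have key : ∀ k : ℕ, k ≤ n →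
      |eulerScheme (1 + a * (t / n)) σ (fun k => w (k * (t / n))) k - x (k * δ)|
        ≤ -a * ε' * (k * δ) := by
    intro k
    induction k with
    | zero =>
      intro _
      have := h 0
      simp only [NNReal.coe_zero, intervalIntegral.integral_same, mul_zero, hw, zero_add] at this
      simp [eulerScheme, this]
    | succ k ih =>
      intro hk
      have ih := ih (by omega)
      have hc : Continuous fun s : ℝ => x s.toNNReal := by fun_prop
      have hstep : x ((k + 1 : ℕ) * δ) - x (k * δ)
          = a * (∫ s in (k * δ : ℝ)..((k + 1 : ℕ) * δ : ℝ), x s.toNNReal)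
            + σ * (w ((k + 1 : ℕ) * δ) - w (k * δ)) := by
        rw [← intervalIntegral.integral_interval_sub_left (a := 0)
          (hc.intervalIntegrable _ _) (hc.intervalIntegrable _ _),
          h ((k + 1 : ℕ) * δ), h (k * δ)]
        push_cast
        ring
      have hkt : ((k + 1 : ℕ) * δ : ℝ≥0) ≤ t := by
        rw [← NNReal.coe_le_coe]
        push_cast
        rw [hδr, ← mul_div_assoc, div_le_iff₀ hn0, mul_comm]
        have : ((k : ℝ) + 1) ≤ n := by exact_mod_cast hk
        exact mul_le_mul_of_nonneg_left this t.2
      have hint : |(∫ s in (k * δ : ℝ)..((k + 1 : ℕ) * δ : ℝ), x s.toNNReal) - δ * x (k * δ)|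
          ≤ ε' * δ := by
        have e1 : (δ : ℝ) * x (k * δ)
            = ∫ _ in (k * δ : ℝ)..((k + 1 : ℕ) * δ : ℝ), x (k * δ) := by
          rw [intervalIntegral.integral_const, smul_eq_mul]; push_cast; ring
        rw [e1, ← intervalIntegral.integral_sub (hc.intervalIntegrable _ _) (by simp)]
        have e2 := intervalIntegral.norm_integral_le_of_norm_le_const (a := (k * δ : ℝ))
          (b := ((k + 1 : ℕ) * δ : ℝ)) (C := ε') (f := fun s => x s.toNNReal - x (k * δ)) ?_
        · refine e2.trans_eq ?_
          have : ((k + 1 : ℕ) * δ : ℝ) - k * δ = δ := by push_cast; ring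
          rw [this, abs_of_nonneg (NNReal.coe_nonneg δ)]
        · intro s hs
          have hle : (k * δ : ℝ) ≤ ((k + 1 : ℕ) * δ : ℝ) := by
            push_cast; nlinarith [δ.2]
          rw [Set.uIoc_of_le hle] at hs
          have hs0 : 0 ≤ s := le_trans (by positivity) hs.1.le
          have hs1 : s.toNNReal ∈ Set.Icc 0 t := by
            refine ⟨zero_le, ?_⟩
            rw [Real.toNNReal_le_iff_le_coe]
            refine hs.2.trans ?_
            exact_mod_cast hkt
          have hs2 : (k * δ : ℝ≥0) ∈ Set.Icc 0 t := by
            refine ⟨zero_le, le_trans ?_ hkt⟩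
            exact mul_le_mul_left (by exact_mod_cast Nat.le_succ k) _
          have := hmod _ hs1 _ hs2 ?_
          · rw [Real.dist_eq] at this
            exact this.le
          · rw [NNReal.dist_eq, Real.coe_toNNReal _ hs0, abs_of_nonneg]
            · push_cast
              have := hs.2
              push_cast at this
              linarith [hδr]
            · push_cast
              linarith [hs.1]
      rw [eulerScheme]
      have e3 : (1 + a * (t / n : ℝ)) *
            eulerScheme (1 + a * (t / n)) σ (fun k => w (k * (t / n))) k
          + σ * (w ((k + 1 : ℕ) * (t / n)) - w (k * (t / n))) - x ((k + 1 : ℕ) * δ)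
          = (1 + a * (t / n : ℝ)) *
              (eulerScheme (1 + a * (t / n)) σ (fun k => w (k * (t / n))) k - x (k * δ))
            - a * ((∫ s in (k * δ : ℝ)..((k + 1 : ℕ) * δ : ℝ), x s.toNNReal)
              - δ * x (k * δ)) := by
        rw [← hδr, ← hδ]
        linear_combination -hstep
      rw [e3]
      refine (abs_sub _ _).trans ?_
      rw [abs_mul, abs_mul, abs_of_nonneg haδ, abs_of_nonpos ha]
      have := mul_le_mul_of_nonneg_left hint (neg_nonneg.2 ha)
      have := mul_le_of_le_one_left (abs_nonneg
        (eulerScheme (1 + a * (t / n)) σ (fun k => w (k * (t / n))) k - x (k * δ))) haδ'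
      push_cast at *
      nlinarith
  have := key n le_rfl
  have hnδ : (n * δ : ℝ≥0) = t := by
    rw [hδ, mul_div_cancel₀]
    exact_mod_cast hn0.ne'
  have hnδr : (n * δ : ℝ) = t := by exact_mod_cast congrArg NNReal.toReal hnδ
  rw [hnδ, hnδr] at this
  rw [Real.dist_eq]
  refine lt_of_le_of_lt this ?_
  rw [hε', mul_div_assoc', div_mul_eq_mul_div, div_lt_iff₀ hden]
  nlinarith

/-- The variance of the Euler scheme converges to the variance of the solution. -/
lemma tendsto_eulerVariance (a σ t : ℝ) :
    Tendsto (fun n : ℕ => ∑ i ∈ Finset.range n,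
      ((1 + a * (t / n)) ^ (n - 1 - i) * σ) ^ 2 * (t / n)) atTop (𝓝 (langevinVar a σ t)) := by
  have hsum : ∀ n : ℕ, ∑ i ∈ Finset.range n, ((1 + a * (t / n)) ^ (n - 1 - i) * σ) ^ 2 * (t / n)
      = σ ^ 2 * (t / n * ∑ i ∈ Finset.range n, ((1 + a * (t / n)) ^ 2) ^ i) := by
    intro n
    rw [Finset.sum_range_reflect
      (fun i => ((1 + a * (t / n)) ^ i * σ) ^ 2 * (t / (n : ℝ))) n, Finset.mul_sum,
      Finset.mul_sum]
    refine Finset.sum_congr rfl fun i _ => ?_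
    rw [← pow_mul, mul_comm 2 i, pow_mul]
    ring
  simp only [hsum, langevinVar]
  refine Tendsto.const_mul _ ?_
  rcases eq_or_ne a 0 with rfl | ha
  · simp only [zero_mul, add_zero, one_pow, Finset.sum_const, Finset.card_range, nsmul_eq_mul,
      mul_one, mul_zero, Real.exp_zero, intervalIntegral.integral_const, sub_zero, smul_eq_mul]
    refine tendsto_const_nhds.congr' ?_
    filter_upwards [eventually_gt_atTop 0] with n hn
    field_simp
  · have h0 : Tendsto (fun n : ℕ => a * (t / n)) atTop (𝓝 0) := by
      simpa using (tendsto_const_div_atTop_nhds_zero_nat t).const_mul a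
    have h2 : Tendsto (fun n : ℕ => 2 + a * (t / n)) atTop (𝓝 2) := by
      simpa using h0.const_add 2
    have hpow : Tendsto (fun n : ℕ => ((1 + a * (t / n)) ^ 2) ^ n) atTop
        (𝓝 (Real.exp (2 * a * t))) := by
      have := (Real.tendsto_one_add_div_pow_exp (a * t)).pow 2
      rw [← Real.exp_nat_mul] at this
      convert this using 2 with n
      · rw [← pow_mul, ← pow_mul, mul_comm 2 n, mul_div_assoc]
      · push_cast; ring_nf
    have hlim : Tendsto (fun n : ℕ => (((1 + a * (t / n)) ^ 2) ^ n - 1) / (a * (2 + a * (t / n))))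
        atTop (𝓝 ((Real.exp (2 * a * t) - 1) / (a * 2))) :=
      (hpow.sub_const 1).div (h2.const_mul a) (by simpa using ha)
    have hval : ∫ s in (0 : ℝ)..t, Real.exp (2 * a * s) = (Real.exp (2 * a * t) - 1) / (a * 2) := by
      rw [← mul_integral_exp]; field_simp
    rw [hval]
    refine hlim.congr' ?_
    filter_upwards [h2.eventually_ne (two_ne_zero)] with n hn
    rw [div_eq_iff (mul_ne_zero ha hn)]
    have := geom_sum_mul ((1 + a * (t / n)) ^ 2) n
    rw [← this]
    ring

/-! ### The law of the solution -/

section Law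

variable {Ω : Type*} [MeasurableSpace Ω] {μ : Measure Ω} {a σ : ℝ} {w x : ℝ≥0 → Ω → ℝ}

lemma charFun_map_eulerValue (hw : IsPreBrownianReal w μ) (a σ : ℝ) (t : ℝ≥0) (n : ℕ) (ξ : ℝ) :
    charFun (μ.map fun ω => eulerValue a σ t n fun s => w s ω) ξ
      = Complex.exp (-((∑ i ∈ Finset.range n,
        ((1 + a * ((t : ℝ) / n)) ^ (n - 1 - i) * σ) ^ 2 * ((t : ℝ) / n) : ℝ) * ξ ^ 2 / 2)) := by
  have hprob : IsProbabilityMeasure μ := (hw.hasLaw_eval 0).isProbabilityMeasure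
  set δ : ℝ≥0 := t / n with hδ
  have hδr : (δ : ℝ) = t / n := by simp [hδ]
  have hmono : Monotone fun k : ℕ => (k : ℝ≥0) * δ := fun i j hij =>
    mul_le_mul_left (by exact_mod_cast hij) _
  set c : ℕ → ℝ := fun i => (1 + a * ((t : ℝ) / n)) ^ (n - 1 - i) * σ with hc
  have hlaw : ∀ i, HasLaw (fun ω => c i * (w ((i + 1 : ℕ) * δ) ω - w (i * δ) ω))
      (gaussianReal 0 (NNReal.mk (c i ^ 2) (sq_nonneg _) * δ)) μ := by
    intro i
    have h1 := hw.hasLaw_sub ((i + 1 : ℕ) * δ) (i * δ)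
    have h2 : nndist (((i + 1 : ℕ) * δ : ℝ≥0) : ℝ) ((i * δ : ℝ≥0) : ℝ) = δ := by
      rw [← NNReal.coe_inj, coe_nndist, Real.dist_eq]
      push_cast
      rw [add_mul, one_mul, add_sub_cancel_left, abs_of_nonneg (NNReal.coe_nonneg δ)]
    change HasLaw _ (gaussianReal 0 (nndist (((i + 1 : ℕ) * δ : ℝ≥0) : ℝ) ((i * δ : ℝ≥0) : ℝ))) μ
      at h1
    rw [h2] at h1
    simpa using gaussianReal_const_mul h1 (c i)
  have hind : iIndepFun (fun (i : ℕ) ω => c i * (w ((i + 1 : ℕ) * δ) ω - w (i * δ) ω)) μ :=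
    (hw.hasIndepIncrements.nat hmono).comp (fun i y => c i * y) (fun i => by fun_prop)
  have hsum : (fun ω => eulerValue a σ t n fun s => w s ω)
      = fun ω => ∑ i ∈ Finset.range n, c i * (w ((i + 1 : ℕ) * δ) ω - w (i * δ) ω) := by
    funext ω
    rw [eulerValue, eulerScheme_eq_sum]
  rw [hsum, (hind.restrict _).charFun_map_fun_finsetSum_eq_prod fun i _ => (hlaw i).aemeasurable,
    Finset.prod_apply]
  simp_rw [(hlaw _).map_eq, charFun_gaussianReal]
  rw [← Complex.exp_sum]
  congr 1
  rw [Complex.ofReal_sum, Finset.sum_mul, Finset.sum_div, ← Finset.sum_neg_distrib]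
  refine Finset.sum_congr rfl fun i _ => ?_
  simp [hc, hδr]

namespace IsLangevinSolution

lemma isProbabilityMeasure (h : IsLangevinSolution μ a σ w x) : IsProbabilityMeasure μ :=
  (h.brownian.hasLaw_eval 0).isProbabilityMeasure

lemma ae_tendsto_eulerValue (h : IsLangevinSolution μ a σ w x) (ha : a ≤ 0) (t : ℝ≥0) :
    ∀ᵐ ω ∂μ, Tendsto (fun n => eulerValue a σ t n fun s => w s ω) atTop (𝓝 (x t ω)) := by
  filter_upwards [h.continuous_paths, h.integral_eq, h.brownian.eval_zero_ae_eq_zero]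
    with ω h1 h2 h3
  exact tendsto_eulerValue ha h1 h3 h2 t

lemma aemeasurable_eulerValue (h : IsLangevinSolution μ a σ w x) (t : ℝ≥0) (n : ℕ) :
    AEMeasurable (fun ω => eulerValue a σ t n fun s => w s ω) μ := by
  have := h.brownian.aemeasurable
  unfold eulerValue
  simp only [eulerScheme_eq_sum]
  fun_prop

lemma aemeasurable (h : IsLangevinSolution μ a σ w x) (ha : a ≤ 0) (t : ℝ≥0) :
    AEMeasurable (x t) μ :=
  aemeasurable_of_tendsto_metrizable_ae' (h.aemeasurable_eulerValue t)
    (h.ae_tendsto_eulerValue ha t)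

/-- The solution of the Langevin equation at time `t` is a centered Gaussian variable: it is the
almost sure limit of Euler schemes, which are centered Gaussian with converging variances. -/
lemma hasLaw (h : IsLangevinSolution μ a σ w x) (ha : a ≤ 0) (t : ℝ≥0) :
    HasLaw (x t) (gaussianReal 0 (langevinVar a σ t).toNNReal) μ := by
  have hprob := h.isProbabilityMeasure
  have hm := h.aemeasurable ha t
  refine ⟨hm, ?_⟩
  have : IsProbabilityMeasure (μ.map (x t)) := Measure.isProbabilityMeasure_map hm
  refine Measure.ext_of_charFun (funext fun ξ => ?_)
  have hcf : ∀ y : Ω → ℝ, AEMeasurable y μ →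
      charFun (μ.map y) ξ = ∫ ω, Complex.exp (ξ * y ω * Complex.I) ∂μ := by
    intro y hy
    rw [charFun_apply_real, integral_map hy
      (Measurable.aestronglyMeasurable (by fun_prop))]
  have hlim1 : Tendsto (fun n => charFun (μ.map fun ω => eulerValue a σ t n fun s => w s ω) ξ)
      atTop (𝓝 (charFun (μ.map (x t)) ξ)) := by
    simp_rw [hcf _ (h.aemeasurable_eulerValue t _), hcf _ hm]
    refine tendsto_integral_of_dominated_convergence (fun _ => 1) (fun n => ?_)
      (integrable_const _) (fun n => ae_of_all _ fun ω => ?_) ?_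
    · have := h.aemeasurable_eulerValue t n
      exact AEMeasurable.aestronglyMeasurable (by fun_prop)
    · rw [← Complex.ofReal_mul, Complex.norm_exp_ofReal_mul_I]
    · filter_upwards [h.ae_tendsto_eulerValue ha t] with ω hω
      have hcont : Continuous fun y : ℝ => Complex.exp (ξ * y * Complex.I) := by fun_prop
      exact (hcont.tendsto _).comp hω
  have hlim2 : Tendsto (fun n => charFun (μ.map fun ω => eulerValue a σ t n fun s => w s ω) ξ)
      atTop (𝓝 (charFun (gaussianReal 0 (langevinVar a σ t).toNNReal) ξ)) := by
    simp_rw [charFun_map_eulerValue h.brownian.toIsPreBrownianReal]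
    have hcont : Continuous fun y : ℝ => Complex.exp (-(y * ξ ^ 2 / 2)) := by fun_prop
    have := (hcont.tendsto _).comp (tendsto_eulerVariance a σ t)
    rw [charFun_gaussianReal, Real.coe_toNNReal _ (langevinVar_nonneg a σ (NNReal.coe_nonneg t))]
    simpa [Function.comp_def] using this
  exact tendsto_nhds_unique hlim1 hlim2

/-- **Markov property**, first half: after time `s`, the deviation of the solution from the
noiseless flow `e^{au} x(s)` solves the Langevin equation driven by the shifted Wiener process. -/
lemma shift (h : IsLangevinSolution μ a σ w x) (s : ℝ≥0) :
    IsLangevinSolution μ a σ (fun u ω => w (s + u) ω - w s ω)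
      (fun u ω => x (s + u) ω - Real.exp (a * u) * x s ω) where
  brownian := h.brownian.shift s
  continuous_paths := by
    filter_upwards [h.continuous_paths] with ω hω
    fun_prop
  integral_eq := by
    filter_upwards [h.continuous_paths, h.integral_eq] with ω hc hω
    intro u
    have hxc : Continuous fun r : ℝ => x r.toNNReal ω := by fun_prop
    have hsc : Continuous fun r : ℝ => x (s + r.toNNReal) ω := by fun_prop
    have hec : Continuous fun r : ℝ => Real.exp (a * (r.toNNReal : ℝ)) * x s ω := by fun_prop
    rw [intervalIntegral.integral_sub (hsc.intervalIntegrable _ _) (hec.intervalIntegrable _ _)]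
    have h1 : ∫ r in (0 : ℝ)..u, x (s + r.toNNReal) ω
        = (∫ r in (0 : ℝ)..(s + u : ℝ≥0), x r.toNNReal ω) - ∫ r in (0 : ℝ)..s, x r.toNNReal ω := by
      rw [intervalIntegral.integral_interval_sub_left (hxc.intervalIntegrable _ _)
        (hxc.intervalIntegrable _ _)]
      have := intervalIntegral.integral_comp_add_left (a := 0) (b := u)
        (fun r : ℝ => x r.toNNReal ω) s
      rw [add_zero] at this
      rw [NNReal.coe_add, ← this]
      refine intervalIntegral.integral_congr fun r hr => ?_
      rw [Set.uIcc_of_le (NNReal.coe_nonneg u)] at hr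
      rw [Real.toNNReal_add (NNReal.coe_nonneg s) hr.1, Real.toNNReal_coe]
    have h2 : a * ∫ r in (0 : ℝ)..u, Real.exp (a * (r.toNNReal : ℝ)) * x s ω
        = (Real.exp (a * u) - 1) * x s ω := by
      rw [intervalIntegral.integral_mul_const, ← mul_assoc]
      congr 1
      have := mul_integral_exp (a / 2) u
      rw [mul_div_cancel₀ a two_ne_zero] at this
      rw [← this]
      congr 1
      refine intervalIntegral.integral_congr fun r hr => ?_
      rw [Set.uIcc_of_le (NNReal.coe_nonneg u)] at hr
      rw [Real.coe_toNNReal _ hr.1]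
    rw [h1, mul_sub, mul_sub, h2, hω (s + u), hω s]
    ring

/-- **Markov property**, second half: the deviation of the solution from the noiseless flow is
independent of the present, since the two are functionals of the shifted Wiener process and of
the Wiener process up to time `s`. -/
lemma indepFun_shift (h : IsLangevinSolution μ a σ w x) (ha : a ≤ 0) (s u : ℝ≥0) :
    IndepFun (fun ω => x (s + u) ω - Real.exp (a * u) * x s ω) (x s) μ := by
  have hind := h.brownian.indepFun_shift s
  -- the limits of the Euler schemes, as measurable functionals of the path
  let φ : (ℝ≥0 → ℝ) → ℝ := fun p => limsup (fun n => eulerValue a σ u n p) atTop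
  let ψ : (Set.Iic s → ℝ) → ℝ := fun p =>
    limsup (fun n => eulerValue a σ s n fun r =>
      p ⟨min r s, Set.mem_Iic.2 (min_le_right r s)⟩) atTop
  have hφ : Measurable φ := Measurable.limsup fun n => measurable_eulerValue a σ u n
  have hψ : Measurable ψ := Measurable.limsup fun n =>
    (measurable_eulerValue a σ s n).comp (measurable_pi_lambda _ fun r => measurable_pi_apply _)
  refine (hind.comp hφ hψ).congr ?_ ?_
  · filter_upwards [(h.shift s).ae_tendsto_eulerValue ha u] with ω hω
    exact hω.limsup_eq
  · filter_upwards [h.ae_tendsto_eulerValue ha s] with ω hω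
    refine Eq.trans ?_ hω.limsup_eq
    refine congrArg (fun f => limsup f atTop) (funext fun n => ?_)
    refine eulerScheme_congr fun k hk => ?_
    have hle : (k : ℝ≥0) * (s / n) ≤ s := by
      rcases Nat.eq_zero_or_pos n with rfl | hn
      · simp
      · rw [← mul_div_assoc, div_le_iff₀ (by exact_mod_cast hn), mul_comm]
        exact mul_le_mul_right (by exact_mod_cast hk) _
    simp only [min_eq_left hle]

end IsLangevinSolution

end Law

/-! ### Moments -/

section Moments

/-- The fourth moment of a centered Gaussian, read off from the moment generating function. -/
lemma integral_pow_four_gaussianReal (v : ℝ≥0) :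
    ∫ y, y ^ 4 ∂gaussianReal 0 v = 3 * (v : ℝ) ^ 2 := by
  have h0 : (0 : ℝ) ∈ interior (integrableExpSet id (gaussianReal 0 v)) := by
    simp [integrableExpSet_id_gaussianReal]
  have h := iteratedDeriv_mgf_zero h0 4
  simp only [Pi.pow_apply, id] at h
  rw [← h, mgf_id_gaussianReal]
  set f : ℝ → ℝ := fun t => Real.exp (0 * t + v * t ^ 2 / 2) with hf
  have hd : ∀ t, HasDerivAt f (v * t * f t) t := by
    intro t
    have h1 : HasDerivAt (fun t : ℝ => 0 * t + v * t ^ 2 / 2) (v * t) t := by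
      have := ((hasDerivAt_id t).const_mul (0 : ℝ)).add
        ((((hasDerivAt_id t).pow 2).const_mul (v : ℝ)).div_const 2)
      refine this.congr_deriv ?_
      simp only [id]; push_cast; ring
    exact h1.exp.congr_deriv (mul_comm _ _)
  have d1 : deriv f = fun t => v * t * f t := funext fun t => (hd t).deriv
  have d2 : deriv (fun t => v * t * f t) = fun t => (v + v ^ 2 * t ^ 2) * f t := by
    funext t
    have := (((hasDerivAt_id t).const_mul (v : ℝ)).mul (hd t)).deriv
    simp only [id] at this
    refine Eq.trans this ?_
    ring
  have d3 : deriv (fun t => (v + v ^ 2 * t ^ 2) * f t)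
      = fun t => (3 * v ^ 2 * t + v ^ 3 * t ^ 3) * f t := by
    funext t
    have := (((((hasDerivAt_id t).pow 2).const_mul ((v : ℝ) ^ 2)).const_add (v : ℝ)).mul
      (hd t)).deriv
    simp only [id] at this
    refine Eq.trans this ?_
    push_cast; ring_nf
    simp; ring
  have d4 : deriv (fun t => (3 * v ^ 2 * t + v ^ 3 * t ^ 3) * f t)
      = fun t => (3 * v ^ 2 + 6 * v ^ 3 * t ^ 2 + v ^ 4 * t ^ 4) * f t := by
    funext t
    have := ((((hasDerivAt_id t).const_mul (3 * (v : ℝ) ^ 2)).add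
      (((hasDerivAt_id t).pow 3).const_mul ((v : ℝ) ^ 3))).mul (hd t)).deriv
    simp only [id] at this
    refine Eq.trans this ?_
    push_cast; ring_nf
    simp; ring
  simp only [iteratedDeriv_succ, iteratedDeriv_zero, d1, d2, d3, d4]
  simp [hf]

lemma integral_sq_gaussianReal (v : ℝ≥0) : ∫ y, y ^ 2 ∂gaussianReal 0 v = v := by
  have h := variance_of_integral_eq_zero (X := id) (μ := gaussianReal 0 v) aemeasurable_id
    (by simp [integral_id_gaussianReal])
  rw [variance_id_gaussianReal] at h
  simpa using h.symm

variable {Ω : Type*} [MeasurableSpace Ω] {μ : Measure Ω} {a σ : ℝ} {w x : ℝ≥0 → Ω → ℝ}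

lemma integrable_pow_of_hasGaussianLaw {X : Ω → ℝ} (hX : HasGaussianLaw X μ) (k : ℕ) :
    Integrable (fun ω => X ω ^ k) μ := by
  have := hX.isProbabilityMeasure
  have h := (hX.memLp (p := k) (ENNReal.natCast_ne_top k)).integrable_norm_pow'
  refine (integrable_norm_iff (hX.aemeasurable.pow_const k).aestronglyMeasurable).1 ?_
  simpa using h

lemma memLp_sq_of_hasGaussianLaw {X : Ω → ℝ} (hX : HasGaussianLaw X μ) :
    MemLp (fun ω => X ω ^ 2) 2 μ := by
  rw [memLp_two_iff_integrable_sq (hX.aemeasurable.pow_const 2).aestronglyMeasurable]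
  simpa only [← pow_mul] using integrable_pow_of_hasGaussianLaw hX 4

namespace IsLangevinSolution

lemma hasGaussianLaw (h : IsLangevinSolution μ a σ w x) (ha : a ≤ 0) (t : ℝ≥0) :
    HasGaussianLaw (x t) μ := (h.hasLaw ha t).hasGaussianLaw

lemma integral_eq_zero (h : IsLangevinSolution μ a σ w x) (ha : a ≤ 0) (t : ℝ≥0) :
    ∫ ω, x t ω ∂μ = 0 := by
  rw [(h.hasLaw ha t).integral_eq, integral_id_gaussianReal]

lemma integral_sq (h : IsLangevinSolution μ a σ w x) (ha : a ≤ 0) (t : ℝ≥0) :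
    ∫ ω, x t ω ^ 2 ∂μ = langevinVar a σ t := by
  have := (h.hasLaw ha t).integral_comp (f := fun y : ℝ => y ^ 2)
    (Measurable.aestronglyMeasurable (by fun_prop))
  rw [integral_sq_gaussianReal,
    Real.coe_toNNReal _ (langevinVar_nonneg a σ (NNReal.coe_nonneg t))] at this
  exact this

lemma integral_pow_four (h : IsLangevinSolution μ a σ w x) (ha : a ≤ 0) (t : ℝ≥0) :
    ∫ ω, x t ω ^ 4 ∂μ = 3 * langevinVar a σ t ^ 2 := by
  have := (h.hasLaw ha t).integral_comp (f := fun y : ℝ => y ^ 4)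
    (Measurable.aestronglyMeasurable (by fun_prop))
  rw [integral_pow_four_gaussianReal,
    Real.coe_toNNReal _ (langevinVar_nonneg a σ (NNReal.coe_nonneg t))] at this
  exact this

lemma memLp_sq (h : IsLangevinSolution μ a σ w x) (ha : a ≤ 0) (t : ℝ≥0) :
    MemLp (fun ω => x t ω ^ 2) 2 μ := memLp_sq_of_hasGaussianLaw (h.hasGaussianLaw ha t)

/-- The covariance of the squared solution at times `s` and `s + u`, by the Markov property. -/
lemma covariance_sq (h : IsLangevinSolution μ a σ w x) (ha : a ≤ 0) (s u : ℝ≥0) :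
    cov[fun ω => x s ω ^ 2, fun ω => x (s + u) ω ^ 2; μ]
      = 2 * Real.exp (2 * a * u) * langevinVar a σ s ^ 2 := by
  have hprob := h.isProbabilityMeasure
  set y : Ω → ℝ := fun ω => x (s + u) ω - Real.exp (a * u) * x s ω with hy
  set e := Real.exp (a * u) with he
  have hee : Real.exp (2 * a * u) = e ^ 2 := by
    rw [he, ← Real.exp_nat_mul]; push_cast; ring_nf
  have hind : IndepFun y (x s) μ := h.indepFun_shift ha s u
  have hyG : HasGaussianLaw y μ := (h.shift s).hasGaussianLaw ha u
  have hxG := h.hasGaussianLaw ha s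
  have hy1 : ∫ ω, y ω ∂μ = 0 := (h.shift s).integral_eq_zero ha u
  have hy2 : ∫ ω, y ω ^ 2 ∂μ = langevinVar a σ u := (h.shift s).integral_sq ha u
  have hi13 : IndepFun y (fun ω => x s ω ^ 3) μ :=
    hind.comp (φ := id) (ψ := fun z : ℝ => z ^ 3) measurable_id (by fun_prop)
  have hi22 : IndepFun (fun ω => y ω ^ 2) (fun ω => x s ω ^ 2) μ :=
    hind.comp (φ := fun z : ℝ => z ^ 2) (ψ := fun z : ℝ => z ^ 2) (by fun_prop) (by fun_prop)
  have hE13 : ∫ ω, y ω * x s ω ^ 3 ∂μ = 0 := by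
    rw [hi13.integral_fun_mul_eq_mul_integral hyG.aemeasurable.aestronglyMeasurable
      (integrable_pow_of_hasGaussianLaw hxG 3).aestronglyMeasurable, hy1, zero_mul]
  have hE22 : ∫ ω, y ω ^ 2 * x s ω ^ 2 ∂μ = langevinVar a σ u * langevinVar a σ s := by
    rw [hi22.integral_fun_mul_eq_mul_integral
      (integrable_pow_of_hasGaussianLaw hyG 2).aestronglyMeasurable
      (integrable_pow_of_hasGaussianLaw hxG 2).aestronglyMeasurable, hy2, h.integral_sq ha]
  have hI13 : Integrable (fun ω => y ω * x s ω ^ 3) μ :=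
    hi13.integrable_mul hyG.integrable (integrable_pow_of_hasGaussianLaw hxG 3)
  have hI22 : Integrable (fun ω => y ω ^ 2 * x s ω ^ 2) μ :=
    hi22.integrable_mul (integrable_pow_of_hasGaussianLaw hyG 2)
      (integrable_pow_of_hasGaussianLaw hxG 2)
  have hI4 := integrable_pow_of_hasGaussianLaw hxG 4
  rw [covariance_eq_sub (h.memLp_sq ha s) (h.memLp_sq ha (s + u)), h.integral_sq ha,
    h.integral_sq ha]
  have hexp : ∀ ω, ((fun ω => x s ω ^ 2) * fun ω => x (s + u) ω ^ 2) ω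
      = e ^ 2 * x s ω ^ 4 + 2 * e * (y ω * x s ω ^ 3) + y ω ^ 2 * x s ω ^ 2 := by
    intro ω
    simp only [Pi.mul_apply, hy]
    ring
  simp_rw [hexp]
  have hA : Integrable (fun ω => e ^ 2 * x s ω ^ 4 + 2 * e * (y ω * x s ω ^ 3)) μ :=
    (hI4.const_mul _).add (hI13.const_mul _)
  rw [integral_add hA hI22,
    integral_add (hI4.const_mul _) (hI13.const_mul _), integral_const_mul, integral_const_mul,
    hE13, hE22, h.integral_pow_four ha, NNReal.coe_add, langevinVar_add, hee]
  have h3 : Real.exp (2 * a * s) * langevinVar a σ u + langevinVar a σ s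
      = Real.exp (2 * a * u) * langevinVar a σ s + langevinVar a σ u := by
    rw [← langevinVar_add, ← langevinVar_add, add_comm]
  rw [h3, hee]
  ring

end IsLangevinSolution

end Moments

/-! ### Mean and variance of the estimators -/

/-- The geometric sum `w_k = ∑_{i < k} qⁱ`: on a grid of mesh `h`, the variance of the solution at
time `k h` is `w_k` times the variance at time `h`, where `q = e^{2ah}`. -/
noncomputable def geomWeight (q : ℝ) (k : ℕ) : ℝ := ∑ i ∈ Finset.range k, q ^ i

lemma geomWeight_zero (q : ℝ) : geomWeight q 0 = 0 := by simp [geomWeight]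

lemma geomWeight_succ (q : ℝ) (k : ℕ) : geomWeight q (k + 1) = q * geomWeight q k + 1 :=
  geom_sum_succ

lemma langevinVar_nat_mul (a σ h : ℝ) (k : ℕ) :
    langevinVar a σ (k * h) = langevinVar a σ h * geomWeight (Real.exp (2 * a * h)) k := by
  induction k with
  | zero => simp [geomWeight_zero, langevinVar_zero]
  | succ k ih =>
    rw [geomWeight_succ, Nat.cast_succ, add_mul, one_mul, add_comm, langevinVar_add, ih]
    ring

/-- With `g = γ^h` and `q = e^{2ah}`, the mean of the Riemann sum estimator is
`h v(h) ∑_{k < N} gᵏ w_k`. -/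
noncomputable def discountedSum (g q : ℝ) (N : ℕ) : ℝ :=
  ∑ k ∈ Finset.range N, g ^ k * geomWeight q k

/-- With `g = γ^h` and `q = e^{2ah}`, the variance of the Riemann sum estimator is `2 h² v(h)²`
times the double sum `∑_{k, l < N} g^{k+l} q^{|k-l|} w_{min(k,l)}²`, here arranged by the larger index. -/
noncomputable def discountedSqSum (g q : ℝ) (N : ℕ) : ℝ :=
  ∑ l ∈ Finset.range N, ((g ^ 2) ^ l * geomWeight q l ^ 2
    + 2 * (g ^ l * ∑ k ∈ Finset.range l, g ^ k * q ^ (l - k) * geomWeight q k ^ 2))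

/-- The mean of the Riemann sum estimator. -/
noncomputable def riemannMean (a γ σ h : ℝ) (N : ℕ) : ℝ :=
  h * langevinVar a σ h * discountedSum (γ ^ h) (Real.exp (2 * a * h)) N

/-- The variance of the Riemann sum estimator. -/
noncomputable def riemannVar (a γ σ h : ℝ) (N : ℕ) : ℝ :=
  2 * h ^ 2 * langevinVar a σ h ^ 2 * discountedSqSum (γ ^ h) (Real.exp (2 * a * h)) N

/-- A symmetric double sum over a square, arranged by the larger index. -/
lemma sum_range_sum_range_of_symm (f : ℕ → ℕ → ℝ) (hf : ∀ k l, f k l = f l k) (N : ℕ) :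
    ∑ k ∈ Finset.range N, ∑ l ∈ Finset.range N, f k l
      = ∑ l ∈ Finset.range N, (f l l + 2 * ∑ k ∈ Finset.range l, f k l) := by
  induction N with
  | zero => simp
  | succ N ih =>
    rw [Finset.sum_range_succ, Finset.sum_range_succ (fun l => f N l),
      Finset.sum_range_succ (fun l => f l l + 2 * ∑ k ∈ Finset.range l, f k l), ← ih]
    simp_rw [Finset.sum_range_succ (fun l => f _ l)]
    rw [Finset.sum_add_distrib, Finset.sum_congr rfl fun k _ => hf N k]
    ring

section Estimators

variable {Ω : Type*} [MeasurableSpace Ω] {μ : Measure Ω} {a γ σ h : ℝ}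

namespace IsLangevinSolution

variable {w x : ℝ≥0 → Ω → ℝ}

lemma memLp_riemannEstimator (hx : IsLangevinSolution μ a σ w x) (ha : a ≤ 0) (γ h : ℝ) (N : ℕ) :
    MemLp (riemannEstimator γ h N x) 2 μ :=
  memLp_finsetSum (Finset.range N) (f := fun (k : ℕ) ω =>
    γ ^ ((k : ℝ) * h) * h * x ((k : ℝ) * h).toNNReal ω ^ 2)
    fun _ _ => (hx.memLp_sq ha _).const_mul _

lemma integral_riemannEstimator (hx : IsLangevinSolution μ a σ w x) (ha : a ≤ 0) (hγ : 0 < γ)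
    (hh : 0 < h) (N : ℕ) :
    ∫ ω, riemannEstimator γ h N x ω ∂μ = riemannMean a γ σ h N := by
  have hprob := hx.isProbabilityMeasure
  unfold riemannEstimator
  rw [integral_finsetSum _ fun k _ =>
    (integrable_pow_of_hasGaussianLaw (hx.hasGaussianLaw ha _) 2).const_mul _,
    riemannMean, discountedSum, Finset.mul_sum]
  refine Finset.sum_congr rfl fun k _ => ?_
  rw [integral_const_mul, hx.integral_sq ha, Real.coe_toNNReal _ (by positivity),
    langevinVar_nat_mul, mul_comm (k : ℝ) h, Real.rpow_mul hγ.le, Real.rpow_natCast]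
  ring

lemma variance_riemannEstimator (hx : IsLangevinSolution μ a σ w x) (ha : a ≤ 0) (hγ : 0 < γ)
    (hh : 0 < h) (N : ℕ) :
    Var[riemannEstimator γ h N x; μ] = riemannVar a γ σ h N := by
  have hprob := hx.isProbabilityMeasure
  have hm : ∀ k : ℕ, MemLp (fun ω => γ ^ ((k : ℝ) * h) * h * x ((k : ℝ) * h).toNNReal ω ^ 2) 2 μ :=
    fun _ => (hx.memLp_sq ha _).const_mul _
  have hcov : ∀ k l : ℕ, k ≤ l →
      cov[fun ω => γ ^ ((k : ℝ) * h) * h * x ((k : ℝ) * h).toNNReal ω ^ 2,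
        fun ω => γ ^ ((l : ℝ) * h) * h * x ((l : ℝ) * h).toNNReal ω ^ 2; μ]
      = 2 * h ^ 2 * langevinVar a σ h ^ 2 * ((γ ^ h) ^ l * ((γ ^ h) ^ k
        * Real.exp (2 * a * h) ^ (l - k) * geomWeight (Real.exp (2 * a * h)) k ^ 2)) := by
    intro k l hkl
    have hl : ((l : ℝ) * h).toNNReal
        = ((k : ℝ) * h).toNNReal + (((l - k : ℕ) : ℝ) * h).toNNReal := by
      rw [← Real.toNNReal_add (by positivity) (by positivity), ← add_mul, ← Nat.cast_add,
        Nat.add_sub_cancel' hkl]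
    rw [covariance_const_mul_left, covariance_const_mul_right, hl, hx.covariance_sq ha,
      Real.coe_toNNReal _ (by positivity), Real.coe_toNNReal _ (by positivity),
      langevinVar_nat_mul, mul_comm (k : ℝ) h, mul_comm (l : ℝ) h, Real.rpow_mul hγ.le,
      Real.rpow_mul hγ.le, Real.rpow_natCast, Real.rpow_natCast, ← Real.exp_nat_mul,
      show 2 * a * (((l - k : ℕ) : ℝ) * h) = ((l - k : ℕ) : ℝ) * (2 * a * h) by ring]
    ring
  rw [← covariance_self (hx.memLp_riemannEstimator ha γ h N).aestronglyMeasurable.aemeasurable]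
  change cov[fun ω => ∑ k ∈ Finset.range N, _, fun ω => ∑ k ∈ Finset.range N, _; μ] = _
  rw [covariance_fun_sum_fun_sum' (fun k _ => hm k) (fun k _ => hm k),
    sum_range_sum_range_of_symm _ (fun k l => covariance_comm _ _), riemannVar, discountedSqSum,
    Finset.mul_sum]
  refine Finset.sum_congr rfl fun l _ => ?_
  rw [hcov l l le_rfl, Finset.sum_congr rfl fun k hk => hcov k l (Finset.mem_range.1 hk).le,
    ← Finset.mul_sum, ← Finset.mul_sum, Nat.sub_self, pow_zero]
  ring

end IsLangevinSolution

variable {w x : ℕ → ℝ≥0 → Ω → ℝ}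

lemma memLp_monteCarloEstimator (hx : ∀ i, IsLangevinSolution μ a σ (w i) (x i)) (ha : a ≤ 0)
    (γ h : ℝ) (N M : ℕ) : MemLp (monteCarloEstimator γ h N M x) 2 μ :=
  (memLp_finsetSum (Finset.range M) fun i _ =>
    (hx i).memLp_riemannEstimator ha γ h N).const_mul _

/-- Bias-variance decomposition of the mean-squared error. -/
lemma mseInfinite_eq (hx : ∀ i, IsLangevinSolution μ a σ (w i) (x i)) (ha : a ≤ 0)
    (hind : iIndepFun (fun (i : ℕ) (ω : Ω) (t : ℝ≥0) => x i t ω) μ) (hγ : 0 < γ) (hh : 0 < h)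
    (N : ℕ) {M : ℕ} (hM : 0 < M) :
    mseInfinite μ γ h N M x = riemannVar a γ σ h N / M
      + (riemannMean a γ σ h N - expectedCost μ γ (x 0)) ^ 2 := by
  have hprob := (hx 0).isProbabilityMeasure
  have hM' : (M : ℝ) ≠ 0 := by positivity
  have hJ := fun i => (hx i).memLp_riemannEstimator ha γ h N
  have hV := memLp_monteCarloEstimator hx ha γ h N M
  have hmean : ∫ ω, monteCarloEstimator γ h N M x ω ∂μ = riemannMean a γ σ h N := by
    unfold monteCarloEstimator
    rw [integral_const_mul, integral_finsetSum _ fun i _ => (hJ i).integrable one_le_two,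
      Finset.sum_congr rfl fun i _ => (hx i).integral_riemannEstimator ha hγ hh N]
    simp [hM']
  have hindJ : iIndepFun (fun i => riemannEstimator γ h N (x i)) μ := by
    refine hind.comp (fun _ p => ∑ k ∈ Finset.range N,
      γ ^ ((k : ℝ) * h) * h * p ((k : ℝ) * h).toNNReal ^ 2) fun _ => ?_
    fun_prop
  have hvar : Var[monteCarloEstimator γ h N M x; μ] = riemannVar a γ σ h N / M := by
    have h1 := IndepFun.variance_sum (s := Finset.range M) (fun i _ => hJ i)
      fun i _ j _ hij => hindJ.indepFun hij
    rw [Finset.sum_congr rfl fun i _ => (hx i).variance_riemannEstimator ha hγ hh N] at h1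
    have h2 := variance_const_mul (1 / (M : ℝ))
      (∑ i ∈ Finset.range M, riemannEstimator γ h N (x i)) μ
    rw [h1] at h2
    have h3 : monteCarloEstimator γ h N M x
        = fun ω => 1 / (M : ℝ) * (∑ i ∈ Finset.range M, riemannEstimator γ h N (x i)) ω := by
      funext ω
      simp [monteCarloEstimator]
    rw [h3, h2]
    simp
    field_simp
  have hsub : MemLp (fun ω => monteCarloEstimator γ h N M x ω - expectedCost μ γ (x 0)) 2 μ :=
    hV.sub (memLp_const _)
  have h4 := variance_eq_sub hsub
  rw [variance_sub_const hV.aestronglyMeasurable, hvar,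
    integral_sub (hV.integrable one_le_two) (integrable_const _), hmean] at h4
  simp only [Pi.pow_apply, integral_const, probReal_univ, smul_eq_mul, one_mul] at h4
  rw [mseInfinite, h4]
  ring

end Estimators

/-! ### The expected cost -/

lemma tendsto_exp_mul_mul_atTop {L : ℝ} (hL : L < 0) :
    Tendsto (fun t : ℝ => Real.exp (L * t) * t) atTop (𝓝 0) := by
  have h := Real.tendsto_pow_mul_exp_neg_atTop_nhds_zero 1
  have h2 : Tendsto (fun t : ℝ => -L * t) atTop atTop :=
    tendsto_id.const_mul_atTop (neg_pos.2 hL)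
  have h3 := (h.comp h2).const_mul (-L)⁻¹
  rw [mul_zero] at h3
  refine h3.congr fun t => ?_
  have : -L ≠ 0 := (neg_pos.2 hL).ne'
  simp only [Function.comp, pow_one]
  rw [← mul_assoc, ← mul_assoc, inv_mul_cancel₀ this, one_mul, mul_comm]
  congr 2
  ring

/-- The discounted variance is integrable and its integral is `σ² / (L (L + 2a))`: since
`v' = 2av + σ²`, it has the antiderivative `e^{Lt} (v - σ² / L) / (L + 2a)`. -/
lemma integral_exp_mul_langevinVar {a L : ℝ} (ha : a ≤ 0) (hL : L < 0) (σ : ℝ) :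
    IntegrableOn (fun t => Real.exp (L * t) * langevinVar a σ t) (Set.Ioi 0) ∧
    ∫ t in Set.Ioi (0 : ℝ), Real.exp (L * t) * langevinVar a σ t = σ ^ 2 / (L * (L + 2 * a)) := by
  have hLa : L + 2 * a ≠ 0 := by linarith
  set F : ℝ → ℝ := fun t => Real.exp (L * t) * (langevinVar a σ t - σ ^ 2 / L) / (L + 2 * a) with hF
  have hd : ∀ t, HasDerivAt F (Real.exp (L * t) * langevinVar a σ t) t := by
    intro t
    have h1 : HasDerivAt (fun t : ℝ => Real.exp (L * t)) (Real.exp (L * t) * (L * 1)) t :=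
      ((hasDerivAt_id t).const_mul L).exp
    have h2 := ((h1.mul ((hasDerivAt_langevinVar a σ t).sub_const (σ ^ 2 / L))).div_const
      (L + 2 * a))
    refine h2.congr_deriv ?_
    have h3 := mul_langevinVar a σ t
    rw [div_eq_iff hLa]
    have h4 : L * (σ ^ 2 / L) = σ ^ 2 := mul_div_cancel₀ _ hL.ne
    linear_combination (-Real.exp (L * t)) * h3 - Real.exp (L * t) * h4
  have hlim : Tendsto F atTop (𝓝 0) := by
    have h0 : Tendsto (fun t : ℝ => Real.exp (L * t)) atTop (𝓝 0) :=
      Real.tendsto_exp_atBot.comp (tendsto_id.const_mul_atTop_of_neg hL)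
    have h1 : Tendsto (fun t : ℝ => Real.exp (L * t) * langevinVar a σ t) atTop (𝓝 0) := by
      refine tendsto_of_tendsto_of_tendsto_of_le_of_le' tendsto_const_nhds
        (by simpa using (tendsto_exp_mul_mul_atTop hL).const_mul (σ ^ 2)) ?_ ?_
      · filter_upwards [eventually_ge_atTop 0] with t ht
        exact mul_nonneg (Real.exp_pos _).le (langevinVar_nonneg a σ ht)
      · filter_upwards [eventually_ge_atTop 0] with t ht
        have := mul_le_mul_of_nonneg_left (langevinVar_le ha σ ht) (Real.exp_pos (L * t)).le
        linarith
    have h2 := (h1.sub (h0.mul_const (σ ^ 2 / L))).div_const (L + 2 * a)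
    simp only [zero_mul, sub_zero, zero_div] at h2
    exact h2.congr fun t => by rw [hF]; ring
  have hint : IntegrableOn (fun t => Real.exp (L * t) * langevinVar a σ t) (Set.Ioi 0) :=
    integrableOn_Ioi_deriv_of_nonneg (hd 0).continuousAt.continuousWithinAt (fun t _ => hd t)
      (fun t ht => mul_nonneg (Real.exp_pos _).le
        (langevinVar_nonneg a σ (le_of_lt (Set.mem_Ioi.1 ht)))) hlim
  refine ⟨hint, ?_⟩
  rw [integral_Ioi_of_hasDerivAt_of_tendsto (hd 0).continuousAt.continuousWithinAt
    (fun t _ => hd t) hint hlim]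
  simp only [hF, mul_zero, Real.exp_zero, langevinVar_zero]
  have := hL.ne
  field_simp
  ring

namespace IsLangevinSolution

variable {Ω : Type*} [MeasurableSpace Ω] {μ : Measure Ω} {a γ σ : ℝ} {w x : ℝ≥0 → Ω → ℝ}

lemma measurable_apply_nat_index {y : ℕ → Ω → ℝ} (hy : ∀ k, Measurable (y k)) {k : ℝ × Ω → ℕ}
    (hk : Measurable k) : Measurable fun p => y (k p) p.2 := by
  have h : Measurable fun q : ℕ × Ω => y q.1 q.2 := measurable_from_prod_countable_right hy
  exact h.comp (hk.prodMk measurable_snd)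

/-- The solution is jointly measurable up to null sets: it is the limit of its piecewise constant
interpolations on finer and finer grids. -/
lemma aestronglyMeasurable_uncurry (hx : IsLangevinSolution μ a σ w x) (ha : a ≤ 0)
    (ν : Measure ℝ) [SFinite ν] :
    AEStronglyMeasurable (fun p : ℝ × Ω => x p.1.toNNReal p.2) (ν.prod μ) := by
  have hprob := hx.isProbabilityMeasure
  have hm := fun (n k : ℕ) => hx.aemeasurable ha ((k / n : ℝ).toNNReal)
  let y : ℕ → ℕ → Ω → ℝ := fun n k => (hm n k).mk
  let g : ℕ → ℝ × Ω → ℝ := fun n p => y n ⌊max p.1 0 * n⌋₊ p.2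
  have hg : ∀ n, Measurable (g n) := by
    intro n
    have h2 : Measurable fun p : ℝ × Ω => ⌊max p.1 0 * (n : ℝ)⌋₊ :=
      ((measurable_fst.max measurable_const).mul_const (n : ℝ)).nat_floor
    exact measurable_apply_nat_index (fun k => (hm n k).measurable_mk) h2
  refine aestronglyMeasurable_of_tendsto_ae atTop (fun n => (hg n).aestronglyMeasurable) ?_
  have hae : ∀ᵐ ω ∂μ, (Continuous fun t : ℝ≥0 => x t ω) ∧
      ∀ n k : ℕ, x ((k / n : ℝ).toNNReal) ω = y n k ω := by
    filter_upwards [hx.continuous_paths, ae_all_iff.2 fun n => ae_all_iff.2 fun k =>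
      (hm n k).ae_eq_mk] with ω h1 h2
    exact ⟨h1, h2⟩
  filter_upwards [Measure.quasiMeasurePreserving_snd.ae hae] with p hp
  have h1 : Tendsto (fun n : ℕ => ((⌊max p.1 0 * n⌋₊ : ℝ) / n)) atTop (𝓝 (max p.1 0)) :=
    (tendsto_nat_floor_mul_div_atTop (le_max_right p.1 0)).comp tendsto_natCast_atTop_atTop
  have hc : Continuous fun r : ℝ => x r.toNNReal p.2 := by
    have := hp.1
    fun_prop
  have h2 := (hc.tendsto _).comp h1
  have h3 : (max p.1 0).toNNReal = p.1.toNNReal := by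
    rw [← NNReal.coe_inj]
    simp
  rw [h3] at h2
  exact h2.congr fun n => hp.2 n _

lemma integrable_discounted (hx : IsLangevinSolution μ a σ w x) (ha : a ≤ 0) (hγ0 : 0 < γ)
    (hγ1 : γ < 1) :
    Integrable (fun p : ℝ × Ω => γ ^ p.1 * x p.1.toNNReal p.2 ^ 2)
      ((volume.restrict (Set.Ioi (0 : ℝ))).prod μ) := by
  have hprob := hx.isProbabilityMeasure
  have hmeas : AEStronglyMeasurable (fun p : ℝ × Ω => γ ^ p.1 * x p.1.toNNReal p.2 ^ 2)
      ((volume.restrict (Set.Ioi (0 : ℝ))).prod μ) := by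
    refine AEStronglyMeasurable.mul ?_ ((hx.aestronglyMeasurable_uncurry ha _).pow 2)
    exact Measurable.aestronglyMeasurable (by fun_prop)
  rw [integrable_prod_iff hmeas]
  refine ⟨ae_of_all _ fun t =>
    (integrable_pow_of_hasGaussianLaw (hx.hasGaussianLaw ha t.toNNReal) 2).const_mul (γ ^ t), ?_⟩
  have h := (integral_exp_mul_langevinVar ha (Real.log_neg hγ0 hγ1) σ).1
  refine h.congr_fun (fun t ht => ?_) measurableSet_Ioi
  have hnn : ∀ ω, ‖γ ^ t * x t.toNNReal ω ^ 2‖ = γ ^ t * x t.toNNReal ω ^ 2 := fun ω =>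
    Real.norm_of_nonneg (mul_nonneg (Real.rpow_nonneg hγ0.le _) (sq_nonneg _))
  simp only [hnn]
  rw [integral_const_mul, hx.integral_sq ha, Real.coe_toNNReal _ (le_of_lt ht),
    Real.rpow_def_of_pos hγ0]

lemma expectedCost_eq (hx : IsLangevinSolution μ a σ w x) (ha : a ≤ 0) (hγ0 : 0 < γ)
    (hγ1 : γ < 1) :
    expectedCost μ γ x = σ ^ 2 / (Real.log γ * (Real.log γ + 2 * a)) := by
  have hprob := hx.isProbabilityMeasure
  have hI := hx.integrable_discounted ha hγ0 hγ1
  unfold expectedCost discountedCost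
  rw [← integral_prod_symm _ hI, integral_prod _ hI,
    ← (integral_exp_mul_langevinVar ha (Real.log_neg hγ0 hγ1) σ).2]
  refine setIntegral_congr_fun measurableSet_Ioi fun t ht => ?_
  simp only
  rw [integral_const_mul, hx.integral_sq ha, Real.coe_toNNReal _ (le_of_lt ht),
    Real.rpow_def_of_pos hγ0]

end IsLangevinSolution

/-! ### Closed forms of the discounted sums -/

lemma discountedSum_eq {g q : ℝ} (hg : 1 - g ≠ 0) (hgq : 1 - g * q ≠ 0) (N : ℕ) :
    discountedSum g q N = g / ((1 - g) * (1 - g * q))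
      - g ^ N * ((geomWeight q N + g / (1 - g)) / (1 - g * q)) := by
  induction N with
  | zero =>
    simp only [discountedSum, Finset.range_zero, Finset.sum_empty, geomWeight_zero]
    field_simp
    ring
  | succ N ih =>
    rw [discountedSum, Finset.sum_range_succ, ← discountedSum, ih, geomWeight_succ]
    field_simp
    ring

/-- The coefficients `α`, `β`, `δ` are those for which
`Fₖ = (g²)ᵏ (α w_k² + β w_k + δ) + 2 / (1 - gq) gᵏ ∑_{j < k} gʲ q^{k-j} w_j²` telescopes to the
summand of `discountedSqSum`. -/
lemma discountedSqSum_eq {g q : ℝ} (hg : 1 - g ^ 2 ≠ 0) (hgq : 1 - g * q ≠ 0)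
    (hggq : 1 - g ^ 2 * q ≠ 0) {α β δ : ℝ} (hα : α = 1 / (1 - g * q) ^ 2)
    (hβ : β = 2 * g ^ 2 * q * α / (1 - g ^ 2 * q)) (hδ : δ = g ^ 2 * (α + β) / (1 - g ^ 2))
    (N : ℕ) :
    discountedSqSum g q N = δ
      - (g ^ 2) ^ N * (α * geomWeight q N ^ 2 + β * geomWeight q N + δ)
      - 2 / (1 - g * q) * (g ^ N *
        ∑ k ∈ Finset.range N, g ^ k * q ^ (N - k) * geomWeight q k ^ 2) := by
  have eα : α * (1 - g * q) ^ 2 = 1 := by rw [hα]; field_simp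
  have eβ : β * (1 - g ^ 2 * q) = 2 * g ^ 2 * q * α := by rw [hβ]; field_simp
  have eδ : δ * (1 - g ^ 2) = g ^ 2 * (α + β) := by rw [hδ]; field_simp
  have eκ : 2 / (1 - g * q) * (1 - g * q) = 2 := div_mul_cancel₀ _ hgq
  have eακ : α * (1 - g ^ 2 * q ^ 2) = 1 + 2 / (1 - g * q) * (g * q) := by
    rw [hα]; field_simp; ring
  induction N with
  | zero => simp [discountedSqSum, geomWeight_zero]
  | succ N ih =>
    have hA : ∑ k ∈ Finset.range (N + 1), g ^ k * q ^ (N + 1 - k) * geomWeight q k ^ 2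
        = q * ((∑ k ∈ Finset.range N, g ^ k * q ^ (N - k) * geomWeight q k ^ 2)
          + g ^ N * geomWeight q N ^ 2) := by
      rw [Finset.sum_range_succ, mul_add, Finset.mul_sum]
      congr 1
      · refine Finset.sum_congr rfl fun k hk => ?_
        rw [Nat.succ_sub (Finset.mem_range.1 hk).le, pow_succ]
        ring
      · rw [Nat.add_sub_cancel_left, pow_one]
        ring
    rw [discountedSqSum, Finset.sum_range_succ, ← discountedSqSum, ih, geomWeight_succ, hA]
    set A := ∑ k ∈ Finset.range N, g ^ k * q ^ (N - k) * geomWeight q k ^ 2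
    set W := geomWeight q N
    set κ := 2 / (1 - g * q)
    rw [pow_succ (g ^ 2) N, pow_succ g N, show (g ^ 2) ^ N = g ^ N * g ^ N by
      rw [← pow_mul, ← pow_add]; congr 1; ring]
    linear_combination (-(g ^ N * g ^ N * W ^ 2)) * eακ - (g ^ N * g ^ N * W) * eβ
      - (g ^ N * g ^ N) * eδ - (g ^ N * A) * eκ

/-! ### Truncation errors -/

lemma geomWeight_nonneg {q : ℝ} (hq : 0 ≤ q) (k : ℕ) : 0 ≤ geomWeight q k :=
  Finset.sum_nonneg fun _ _ => by positivity

lemma geomWeight_le {q : ℝ} (hq : 0 ≤ q) (hq1 : q ≤ 1) (k : ℕ) : geomWeight q k ≤ k := by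
  have := Finset.sum_le_sum fun i (_ : i ∈ Finset.range k) => pow_le_one₀ (n := i) hq hq1
  simpa [geomWeight] using this

lemma abs_discountedSum_sub_le {g q d : ℝ} (hg0 : 0 ≤ g) (hg1 : g ≤ 1) (hq0 : 0 ≤ q) (hq1 : q ≤ 1)
    (hd : 0 < d) (hgd : d ≤ 1 - g) (N : ℕ) :
    |discountedSum g q N - g / ((1 - g) * (1 - g * q))| ≤ g ^ N * ((N + 1 / d) / d) := by
  have hgq : d ≤ 1 - g * q := by nlinarith
  have h1 : 0 < 1 - g := hd.trans_le hgd
  have h2 : 0 < 1 - g * q := hd.trans_le hgq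
  have hw := geomWeight_nonneg hq0 N
  rw [discountedSum_eq h1.ne' h2.ne', sub_sub_cancel_left, abs_neg, abs_of_nonneg (by positivity)]
  gcongr
  exact geomWeight_le hq0 hq1 N

lemma abs_discountedSqSum_sub_le {g q d : ℝ} (hg0 : 0 ≤ g) (hg1 : g ≤ 1) (hq0 : 0 ≤ q)
    (hq1 : q ≤ 1) (hd : 0 < d) (hgd : d ≤ 1 - g) (N : ℕ) :
    |discountedSqSum g q N
      - g ^ 2 * (1 + g ^ 2 * q) / ((1 - g * q) ^ 2 * (1 - g ^ 2) * (1 - g ^ 2 * q))|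
      ≤ g ^ N * (N ^ 2 / d ^ 2 + 2 * N / d ^ 3 + 3 / d ^ 4 + 2 * N ^ 3 / d) := by
  have hd1 : d ≤ 1 := by linarith
  have hgg : g ^ 2 ≤ g := by nlinarith
  have hgq : d ≤ 1 - g * q := by nlinarith
  have hgg' : d ≤ 1 - g ^ 2 := by linarith
  have hggq : d ≤ 1 - g ^ 2 * q := by nlinarith
  have h1 : 0 < 1 - g ^ 2 := hd.trans_le hgg'
  have h2 : 0 < 1 - g * q := hd.trans_le hgq
  have h3 : 0 < 1 - g ^ 2 * q := hd.trans_le hggq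
  have hw := geomWeight_nonneg hq0 N
  set α : ℝ := 1 / (1 - g * q) ^ 2 with hα
  set β : ℝ := 2 * g ^ 2 * q * α / (1 - g ^ 2 * q) with hβ
  set δ : ℝ := g ^ 2 * (α + β) / (1 - g ^ 2) with hδ
  have hδ' : g ^ 2 * (1 + g ^ 2 * q) / ((1 - g * q) ^ 2 * (1 - g ^ 2) * (1 - g ^ 2 * q)) = δ := by
    rw [hδ, hβ, hα]
    field_simp
    ring
  have hα0 : 0 ≤ α := by positivity
  have hβ0 : 0 ≤ β := by positivity
  have hδ0 : 0 ≤ δ := by positivity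
  have hα1 : α ≤ 1 / d ^ 2 := by rw [hα]; gcongr
  have hβ1 : β ≤ 2 / d ^ 3 := by
    calc β ≤ 2 * 1 * 1 * (1 / d ^ 2) / d := by
          rw [hβ]
          gcongr
          exact pow_le_one₀ hg0 hg1
      _ = 2 / d ^ 3 := by field_simp
  have hδ1 : δ ≤ 3 / d ^ 4 := by
    have h4 : 1 / d ^ 2 ≤ 1 / d ^ 3 :=
      one_div_le_one_div_of_le (by positivity) (pow_le_pow_of_le_one hd.le hd1 (by norm_num))
    calc δ ≤ 1 * (1 / d ^ 3 + 2 / d ^ 3) / d := by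
          rw [hδ]
          gcongr
          · exact pow_le_one₀ hg0 hg1
          · exact hα1.trans h4
      _ = 3 / d ^ 4 := by field_simp; norm_num
  have hA0 : 0 ≤ ∑ k ∈ Finset.range N, g ^ k * q ^ (N - k) * geomWeight q k ^ 2 :=
    Finset.sum_nonneg fun k _ => by positivity
  have hA1 : ∑ k ∈ Finset.range N, g ^ k * q ^ (N - k) * geomWeight q k ^ 2 ≤ (N : ℝ) ^ 3 := by
    have : ∀ k ∈ Finset.range N, g ^ k * q ^ (N - k) * geomWeight q k ^ 2 ≤ (N : ℝ) ^ 2 := by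
      intro k hk
      have hk1 : geomWeight q k ≤ N := (geomWeight_le hq0 hq1 k).trans
        (by exact_mod_cast (Finset.mem_range.1 hk).le)
      have hk0 := geomWeight_nonneg hq0 k
      calc g ^ k * q ^ (N - k) * geomWeight q k ^ 2 ≤ 1 * 1 * (N : ℝ) ^ 2 := by
            gcongr
            · exact pow_le_one₀ hg0 hg1
            · exact pow_le_one₀ hq0 hq1
        _ = (N : ℝ) ^ 2 := by ring
    refine (Finset.sum_le_sum this).trans_eq ?_
    simp
    ring
  rw [discountedSqSum_eq h1.ne' h2.ne' h3.ne' hα hβ hδ, hδ', abs_sub_comm, sub_sub δ,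
    sub_sub_cancel, abs_of_nonneg (by positivity)]
  have hGN : (g ^ 2) ^ N ≤ g ^ N := pow_le_pow_left₀ (sq_nonneg g) hgg N
  calc _ ≤ g ^ N * (1 / d ^ 2 * (N : ℝ) ^ 2 + 2 / d ^ 3 * N + 3 / d ^ 4)
        + 2 / d * (g ^ N * (N : ℝ) ^ 3) := by
        gcongr
        · exact geomWeight_le hq0 hq1 N
        · exact geomWeight_le hq0 hq1 N
    _ = _ := by ring

/-- If `e^{LT} ≤ h⁴` then `e^{LT}` stays below a multiple of `h³` even after multiplication by a
cubic polynomial in `T`, as a quarter of the exponential decay absorbs the polynomial. -/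
lemma exists_exp_mul_cubic_le {L : ℝ} (hL : L < 0) :
    ∃ C : ℝ, 0 ≤ C ∧ ∀ T h : ℝ, 0 ≤ T → 0 < h → Real.exp (L * T) ≤ h ^ 4 →
      Real.exp (L * T) * (1 + T) ^ 3 ≤ C * h ^ 3 := by
  set l : ℝ := -L / 4 with hl
  have hl0 : 0 < l := by rw [hl]; linarith
  refine ⟨6 / l ^ 3 * Real.exp l, by positivity, fun T h hT hh hTh => ?_⟩
  set z := Real.exp (-(l * T)) with hz
  have hz0 : 0 < z := Real.exp_pos _
  have hz4 : Real.exp (L * T) = z ^ 4 := by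
    rw [hz, ← Real.exp_nat_mul]
    congr 1
    rw [hl]
    push_cast
    ring
  have hzh : z ≤ h := by
    rw [hz4] at hTh
    exact (pow_le_pow_iff_left₀ hz0.le hh.le (by norm_num)).1 hTh
  have hpoly : (l * (1 + T)) ^ 3 ≤ 6 * (Real.exp l * Real.exp (l * T)) := by
    have := Real.pow_div_factorial_le_exp (l * (1 + T)) (by positivity) 3
    rw [div_le_iff₀ (by positivity), mul_add, Real.exp_add] at this
    norm_num [Nat.factorial] at this
    rw [mul_add]
    linarith
  have hzz : z * Real.exp (l * T) = 1 := by rw [hz, ← Real.exp_add]; simp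
  have h1 : z * (1 + T) ^ 3 ≤ 6 / l ^ 3 * Real.exp l := by
    rw [div_mul_eq_mul_div, le_div_iff₀ (by positivity)]
    calc z * (1 + T) ^ 3 * l ^ 3 = z * (l * (1 + T)) ^ 3 := by ring
      _ ≤ z * (6 * (Real.exp l * Real.exp (l * T))) := by gcongr
      _ = 6 * Real.exp l * (z * Real.exp (l * T)) := by ring
      _ = 6 * Real.exp l := by rw [hzz, mul_one]
  rw [hz4]
  calc z ^ 4 * (1 + T) ^ 3 = (z * (1 + T) ^ 3) * z ^ 3 := by ring
    _ ≤ (6 / l ^ 3 * Real.exp l) * h ^ 3 := by gcongr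

/-! ### Small-step expansions -/

/-- The function `sinh x / x`, with its limit `1` as the value at `0`. -/
noncomputable def sinhc (x : ℝ) : ℝ := if x = 0 then 1 else Real.sinh x / x

lemma mul_sinhc (x : ℝ) : x * sinhc x = Real.sinh x := by
  by_cases hx : x = 0
  · simp [hx]
  · rw [sinhc, if_neg hx, mul_div_cancel₀ _ hx]

lemma sinhc_pos (x : ℝ) : 0 < sinhc x := by
  unfold sinhc
  split_ifs with hx
  · exact one_pos
  · rcases lt_or_gt_of_ne hx with h | h
    · exact div_pos_of_neg_of_neg (Real.sinh_neg_iff.2 h) h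
    · exact div_pos (Real.sinh_pos_iff.2 h) h

lemma one_sub_exp_two_mul (x : ℝ) :
    1 - Real.exp (2 * x) = -(2 * x * Real.exp x * sinhc x) := by
  have h1 : Real.exp (2 * x) = Real.exp x * Real.exp x := by rw [← Real.exp_add]; ring_nf
  have h2 : Real.exp x * Real.exp (-x) = 1 := by rw [← Real.exp_add]; simp
  have h3 := mul_sinhc x
  rw [Real.sinh_eq] at h3
  linear_combination (-1 : ℝ) * h1 - h2 + 2 * Real.exp x * h3

lemma langevinVar_eq_sinhc (a σ h : ℝ) :
    langevinVar a σ h = σ ^ 2 * h * Real.exp (a * h) * sinhc (a * h) := by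
  rcases eq_or_ne a 0 with rfl | ha
  · simp [langevinVar, sinhc]
  · have h1 := mul_langevinVar a σ h
    have h2 := one_sub_exp_two_mul (a * h)
    rw [show 2 * (a * h) = 2 * a * h by ring] at h2
    have h3 : 2 * a ≠ 0 := by simpa using ha
    refine mul_left_cancel₀ h3 ?_
    linear_combination h1 - σ ^ 2 * h2

lemma abs_sinhc_sub_le {x : ℝ} (hx : |x| ≤ 1) : |sinhc x - (1 + x ^ 2 / 6)| ≤ x ^ 4 := by
  rcases eq_or_ne x 0 with rfl | hx0
  · simp [sinhc]
  have hxp : 0 < |x| := abs_pos.2 hx0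
  have h1 := Real.exp_bound hx (n := 5) (by norm_num)
  have h2 := Real.exp_bound (x := -x) (by rwa [abs_neg]) (n := 5) (by norm_num)
  rw [abs_neg] at h2
  simp only [Finset.sum_range_succ, Finset.sum_range_zero, Nat.factorial] at h1 h2
  norm_num at h1 h2
  have h3 : x * (sinhc x - (1 + x ^ 2 / 6)) = Real.sinh x - (x + x ^ 3 / 6) := by
    rw [mul_sub, mul_sinhc]; ring
  have h4 : |x| * |sinhc x - (1 + x ^ 2 / 6)| ≤ |x| * x ^ 4 := by
    rw [← abs_mul, h3, Real.sinh_eq]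
    have h5 : x ^ 4 = |x| ^ 4 := by rw [← abs_pow, abs_of_nonneg (by positivity)]
    rw [h5]
    have h6 : 0 ≤ |x| ^ 5 := by positivity
    rw [abs_le] at h1 h2 ⊢
    constructor <;> nlinarith [h1.1, h1.2, h2.1, h2.2]
  exact le_of_mul_le_mul_left h4 hxp

lemma isBigO_sinhc_sub (c : ℝ) :
    (fun h : ℝ => sinhc (c * h) - (1 + (c * h) ^ 2 / 6)) =O[𝓝 0] fun h => h ^ 4 := by
  refine IsBigO.of_bound (c ^ 4) ?_
  have : Tendsto (fun h : ℝ => |c * h|) (𝓝 0) (𝓝 0) := by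
    have : Continuous fun h : ℝ => |c * h| := by fun_prop
    simpa using this.tendsto 0
  filter_upwards [this.eventually_le_const one_pos] with h hh
  rw [Real.norm_eq_abs, Real.norm_of_nonneg (by positivity), ← mul_pow]
  exact abs_sinhc_sub_le hh

lemma tendsto_sinhc (c : ℝ) : Tendsto (fun h : ℝ => sinhc (c * h)) (𝓝 0) (𝓝 1) := by
  have h1 : Tendsto (fun h : ℝ => h ^ 4) (𝓝 0) (𝓝 0) := by
    simpa using (continuous_pow 4).tendsto (0 : ℝ)
  have h2 : Tendsto (fun h : ℝ => 1 + (c * h) ^ 2 / 6) (𝓝 0) (𝓝 1) := by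
    have : Continuous fun h : ℝ => 1 + (c * h) ^ 2 / 6 := by fun_prop
    simpa using this.tendsto 0
  simpa using ((isBigO_sinhc_sub c).trans_tendsto h1).add h2

/-- Second-order expansion of the factor by which the mean of the untruncated Riemann sum differs
from the expected cost. -/
lemma isBigO_sinhc_div_sub (c₁ c₂ c₃ : ℝ) :
    (fun h : ℝ => sinhc (c₁ * h) / (sinhc (c₂ * h) * sinhc (c₃ * h))
      - (1 - (c₂ ^ 2 + c₃ ^ 2 - c₁ ^ 2) / 6 * h ^ 2)) =O[𝓝 0] fun h => h ^ 4 := by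
  set κ := (c₂ ^ 2 + c₃ ^ 2 - c₁ ^ 2) / 6 with hκ
  have hbd : ∀ {f : ℝ → ℝ}, Continuous f → f =O[𝓝 0] fun _ => (1 : ℝ) := fun hf =>
    (hf.tendsto 0).isBigO_one ℝ
  have hs : (fun h : ℝ => sinhc (c₃ * h)) =O[𝓝 0] fun _ => (1 : ℝ) :=
    (tendsto_sinhc c₃).isBigO_one ℝ
  have hinv : (fun h : ℝ => (sinhc (c₂ * h) * sinhc (c₃ * h))⁻¹) =O[𝓝 0] fun _ => (1 : ℝ) :=
    (((tendsto_sinhc c₂).mul (tendsto_sinhc c₃)).inv₀ (by norm_num)).isBigO_one ℝ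
  have hk : (fun h : ℝ => 1 - κ * h ^ 2) =O[𝓝 0] fun _ => (1 : ℝ) := hbd (by fun_prop)
  have hp : (fun h : ℝ => 1 + (c₂ * h) ^ 2 / 6) =O[𝓝 0] fun _ => (1 : ℝ) := hbd (by fun_prop)
  have t1 := isBigO_sinhc_sub c₁
  have t2 := (hk.mul ((isBigO_sinhc_sub c₂).mul hs))
  have t3 := (hk.mul (hp.mul (isBigO_sinhc_sub c₃)))
  have t4 : (fun h : ℝ => h ^ 4 * (κ * (c₂ ^ 2 / 6 + c₃ ^ 2 / 6) - c₂ ^ 2 / 6 * (c₃ ^ 2 / 6)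
      + κ * (c₂ ^ 2 / 6) * (c₃ ^ 2 / 6) * h ^ 2)) =O[𝓝 0] fun h => h ^ 4 * 1 :=
    (isBigO_refl _ _).mul (hbd (by fun_prop))
  simp only [one_mul, mul_one] at t2 t3 t4
  have t5 := (((t1.sub t2).sub t3).add t4).mul hinv
  simp only [mul_one] at t5
  refine t5.congr_left fun h => ?_
  have h2 := (sinhc_pos (c₂ * h)).ne'
  have h3 := (sinhc_pos (c₃ * h)).ne'
  have h4 : ∀ y, (sinhc (c₁ * h) / (sinhc (c₂ * h) * sinhc (c₃ * h)) - y)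
      * (sinhc (c₂ * h) * sinhc (c₃ * h))
      = sinhc (c₁ * h) - y * (sinhc (c₂ * h) * sinhc (c₃ * h)) := fun y => by
    rw [sub_mul, div_mul_cancel₀ _ (mul_ne_zero h2 h3)]
  rw [← div_eq_mul_inv, div_eq_iff (mul_ne_zero h2 h3), h4, hκ]
  ring

/-- Functions of the form `1 + O(h²)` are closed under products. -/
lemma isBigO_mul_sub_one {f g : ℝ → ℝ} (hf : (fun h => f h - 1) =O[𝓝 0] fun h : ℝ => h ^ 2)
    (hg : (fun h => g h - 1) =O[𝓝 0] fun h : ℝ => h ^ 2) :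
    (fun h => f h * g h - 1) =O[𝓝 0] fun h : ℝ => h ^ 2 := by
  have h0 : Tendsto (fun h : ℝ => h ^ 2) (𝓝 0) (𝓝 0) := by
    simpa using (continuous_pow 2).tendsto (0 : ℝ)
  have hg1 : g =O[𝓝 0] fun _ => (1 : ℝ) := by
    have := ((hg.trans_tendsto h0).add_const 1).isBigO_one ℝ
    simpa using this
  have h1 := (hf.mul hg1).add (hg.congr_right fun h => (mul_one (h ^ 2)).symm)
  simp only [mul_one] at h1
  exact h1.congr_left fun h => by ring

lemma isBigO_inv_sub_one {f : ℝ → ℝ} (hf : (fun h => f h - 1) =O[𝓝 0] fun h : ℝ => h ^ 2)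
    (h0 : ∀ h, f h ≠ 0) : (fun h => (f h)⁻¹ - 1) =O[𝓝 0] fun h : ℝ => h ^ 2 := by
  have hz : Tendsto (fun h : ℝ => h ^ 2) (𝓝 0) (𝓝 0) := by
    simpa using (continuous_pow 2).tendsto (0 : ℝ)
  have ht : Tendsto f (𝓝 0) (𝓝 1) := by
    have := (hf.trans_tendsto hz).add_const 1
    simpa using this
  have h1 := hf.neg_left.mul ((ht.inv₀ one_ne_zero).isBigO_one ℝ)
  simp only [mul_one] at h1
  refine h1.congr_left fun h => ?_
  have := h0 h
  field_simp
  ring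

lemma isBigO_sinhc_sub_one (c : ℝ) :
    (fun h : ℝ => sinhc (c * h) - 1) =O[𝓝 0] fun h => h ^ 2 := by
  have h1 := (isBigO_sinhc_sub c).trans (isLittleO_pow_pow (by norm_num : 2 < 4)).isBigO
  have h2 : (fun h : ℝ => c ^ 2 / 6 * h ^ 2) =O[𝓝 0] fun h => h ^ 2 :=
    (isBigO_refl _ _).const_mul_left _
  exact (h1.add h2).congr_left fun h => by ring

lemma isBigO_cosh_sub_one (c : ℝ) :
    (fun h : ℝ => Real.cosh (c * h) - 1) =O[𝓝 0] fun h => h ^ 2 := by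
  -- `cosh x - 1 = 2 sinh² (x / 2)`
  have hs : (fun h : ℝ => c ^ 2 / 2 * (h ^ 2 * sinhc (c / 2 * h) ^ 2)) =O[𝓝 0]
      fun h => h ^ 2 * 1 ^ 2 :=
    ((isBigO_refl _ _).mul (((tendsto_sinhc (c / 2)).isBigO_one ℝ).pow 2)).const_mul_left _
  simp only [one_pow, mul_one] at hs
  refine hs.congr_left fun h => ?_
  have h1 := Real.cosh_two_mul (c / 2 * h)
  have h2 := Real.cosh_sq (c / 2 * h)
  have h3 := mul_sinhc (c / 2 * h)
  rw [show 2 * (c / 2 * h) = c * h by ring] at h1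
  rw [h1, h2, ← h3]
  ring

lemma isBigO_varianceFactor_sub_one (c₁ c₂ c₃ c₄ : ℝ) :
    (fun h : ℝ => sinhc (c₁ * h) ^ 2 * Real.cosh (c₂ * h)
      / (sinhc (c₃ * h) ^ 2 * (sinhc (c₄ * h) * sinhc (c₂ * h))) - 1) =O[𝓝 0] fun h => h ^ 2 := by
  have hs := isBigO_sinhc_sub_one
  have hnum := isBigO_mul_sub_one (isBigO_mul_sub_one (hs c₁) (hs c₁)) (isBigO_cosh_sub_one c₂)
  have hden := isBigO_mul_sub_one (isBigO_mul_sub_one (hs c₃) (hs c₃))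
    (isBigO_mul_sub_one (hs c₄) (hs c₂))
  have hden' := isBigO_inv_sub_one hden fun h =>
    (mul_pos (mul_pos (sinhc_pos _) (sinhc_pos _)) (mul_pos (sinhc_pos _) (sinhc_pos _))).ne'
  exact (isBigO_mul_sub_one hnum hden').congr_left fun h => by rw [div_eq_mul_inv, sq, sq]

/-! ### Bias and variance of the Riemann sum estimator -/

/-- The mean of the untruncated Riemann sum. Rewriting `1 - e^{2x}` as `-2x eˣ sinhc x` makes all
exponential factors cancel, which leaves an even function of `h`. -/
lemma riemannMean_limit_eq {a L σ h : ℝ} (ha : a ≤ 0) (hL : L < 0) (hh : 0 < h) :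
    h * langevinVar a σ h * (Real.exp (L * h)
        / ((1 - Real.exp (L * h)) * (1 - Real.exp (L * h) * Real.exp (2 * a * h))))
      = σ ^ 2 / (L * (L + 2 * a))
        * (sinhc (a * h) / (sinhc (L / 2 * h) * sinhc ((L / 2 + a) * h))) := by
  have hLa : L + 2 * a ≠ 0 := by linarith
  have hL0 := hL.ne
  have e1 := one_sub_exp_two_mul (L / 2 * h)
  have e2 := one_sub_exp_two_mul ((L / 2 + a) * h)
  set A := Real.exp (a * h) with hA
  set E := Real.exp (L / 2 * h) with hE
  have hA0 : 0 < A := Real.exp_pos _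
  have hE0 : 0 < E := Real.exp_pos _
  have f1 : Real.exp (L * h) = E ^ 2 := by rw [hE, ← Real.exp_nat_mul]; push_cast; ring_nf
  have f2 : Real.exp (2 * a * h) = A ^ 2 := by rw [hA, ← Real.exp_nat_mul]; push_cast; ring_nf
  have f4 : Real.exp ((L / 2 + a) * h) = E * A := by rw [add_mul, Real.exp_add]
  have f5 : ∀ y, Real.exp (2 * y) = Real.exp y ^ 2 := fun y => by
    rw [← Real.exp_nat_mul]; push_cast; rfl
  rw [f5, ← hE] at e1
  rw [f5, f4] at e2
  have g2 : 1 - E ^ 2 * A ^ 2 = 1 - (E * A) ^ 2 := by ring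
  rw [langevinVar_eq_sinhc, ← hA, f1, f2, g2, e1, e2]
  have := sinhc_pos (L / 2 * h)
  have := sinhc_pos ((L / 2 + a) * h)
  rw [show (L / 2 + a) = (L + 2 * a) / 2 by ring] at *
  field_simp

/-- The variance of the untruncated Riemann sum, as an even function of `h`. -/
lemma riemannVar_limit_eq {a L σ h : ℝ} (ha : a ≤ 0) (hL : L < 0) (hh : 0 < h) :
    2 * h ^ 2 * langevinVar a σ h ^ 2 * (Real.exp (L * h) ^ 2
        * (1 + Real.exp (L * h) ^ 2 * Real.exp (2 * a * h))
        / ((1 - Real.exp (L * h) * Real.exp (2 * a * h)) ^ 2 * (1 - Real.exp (L * h) ^ 2)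
          * (1 - Real.exp (L * h) ^ 2 * Real.exp (2 * a * h))))
      = σ ^ 4 * (1 / (L * (a + L) * (2 * a + L) ^ 2)) *
        (sinhc (a * h) ^ 2 * Real.cosh ((a + L) * h) / (sinhc ((L / 2 + a) * h) ^ 2
          * (sinhc (L * h) * sinhc ((a + L) * h)))) := by
  have hLa : 2 * a + L ≠ 0 := by linarith
  have hLa' : a + L ≠ 0 := by linarith
  have hL0 := hL.ne
  have e1 := one_sub_exp_two_mul (L * h)
  have e2 := one_sub_exp_two_mul ((L / 2 + a) * h)
  have e3 := one_sub_exp_two_mul ((a + L) * h)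
  have e4 := Real.cosh_eq ((a + L) * h)
  set A := Real.exp (a * h) with hA
  set E := Real.exp (L / 2 * h) with hE
  have hA0 : 0 < A := Real.exp_pos _
  have hE0 : 0 < E := Real.exp_pos _
  have f1 : Real.exp (L * h) = E ^ 2 := by rw [hE, ← Real.exp_nat_mul]; push_cast; ring_nf
  have f2 : Real.exp (2 * a * h) = A ^ 2 := by rw [hA, ← Real.exp_nat_mul]; push_cast; ring_nf
  have f3 : Real.exp ((a + L) * h) = A * E ^ 2 := by rw [add_mul, Real.exp_add, f1]
  have f4 : Real.exp ((L / 2 + a) * h) = E * A := by rw [add_mul, Real.exp_add]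
  have f5 : ∀ y, Real.exp (2 * y) = Real.exp y ^ 2 := fun y => by
    rw [← Real.exp_nat_mul]; push_cast; rfl
  rw [f5, f1] at e1
  rw [f5, f4] at e2
  rw [f5, f3] at e3
  rw [Real.exp_neg, f3] at e4
  have g1 : 1 - (E ^ 2) ^ 2 * A ^ 2 = 1 - (A * E ^ 2) ^ 2 := by ring
  have g2 : 1 - E ^ 2 * A ^ 2 = 1 - (E * A) ^ 2 := by ring
  rw [langevinVar_eq_sinhc, ← hA, f1, f2, g1, g2, e1, e2, e3, e4]
  have := sinhc_pos (L * h)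
  have := sinhc_pos ((L / 2 + a) * h)
  have := sinhc_pos ((a + L) * h)
  have hLa2 : L / 2 + a ≠ 0 := by linarith
  rw [show (L / 2 + a) = (2 * a + L) / 2 by ring] at *
  field_simp
  ring

lemma pow_le_one_add_cube {T : ℝ} (hT : 0 ≤ T) {k : ℕ} (hk : k ≤ 3) : T ^ k ≤ (1 + T) ^ 3 :=
  (pow_le_pow_left₀ hT (by linarith) k).trans (pow_le_pow_right₀ (by linarith) hk)

lemma neg_log_half_mul_le_one_sub_exp {L h : ℝ} (h0 : 0 ≤ -(L * h)) (h1 : -(L * h) ≤ 1) :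
    -L / 2 * h ≤ 1 - Real.exp (L * h) := by
  have h2 := Real.add_one_le_exp (-(L * h))
  have h3 : Real.exp (L * h) * Real.exp (-(L * h)) = 1 := by rw [← Real.exp_add]; simp
  have h4 := Real.exp_pos (L * h)
  nlinarith

lemma eventually_small_step (L : ℝ) : ∀ᶠ h in 𝓝[>] (0 : ℝ), 0 < h ∧ h ≤ 1 ∧ -(L * h) ≤ 1 := by
  have h1 : Tendsto (fun h : ℝ => -(L * h)) (𝓝 0) (𝓝 0) := by
    have : Continuous fun h : ℝ => -(L * h) := by fun_prop
    simpa using this.tendsto 0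
  filter_upwards [self_mem_nhdsWithin, nhdsWithin_le_nhds (eventually_le_nhds one_pos),
    nhdsWithin_le_nhds (h1.eventually_le_const one_pos)] with h a1 a2 a3
  exact ⟨a1, a2, a3⟩

/-- The bias of the Riemann sum estimator is `-σ² h² / 12` up to `O(h³)`, once the horizon is so
long that `γ^T ≤ h⁴`. -/
lemma exists_riemannMean_sub_le {a γ : ℝ} (ha : a ≤ 0) (hγ0 : 0 < γ) (hγ1 : γ < 1) (σ : ℝ) :
    ∃ K : ℝ, 0 ≤ K ∧ ∀ᶠ h in 𝓝[>] (0 : ℝ), ∀ N : ℕ, γ ^ ((N : ℝ) * h) ≤ h ^ 4 →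
      |riemannMean a γ σ h N - σ ^ 2 / (Real.log γ * (Real.log γ + 2 * a)) + σ ^ 2 / 12 * h ^ 2|
        ≤ K * h ^ 3 := by
  set L := Real.log γ with hLdef
  have hL : L < 0 := Real.log_neg hγ0 hγ1
  have hLa : L + 2 * a ≠ 0 := by linarith
  have hL0 := hL.ne
  obtain ⟨C, hC0, hC⟩ := exists_exp_mul_cubic_le hL
  obtain ⟨K₁, hK₁, hexp⟩ := (isBigO_sinhc_div_sub a (L / 2) (L / 2 + a)).exists_pos
  set c := -L / 2 with hc
  have hc0 : 0 < c := by rw [hc]; linarith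
  set V := σ ^ 2 / (L * (L + 2 * a)) with hV
  refine ⟨σ ^ 2 * (1 / c + 1 / c ^ 2) * C + |V| * K₁, by positivity, ?_⟩
  filter_upwards [eventually_small_step L, nhdsWithin_le_nhds hexp.bound]
    with h ⟨hh, hh1, hLh⟩ hb N hN
  have hg : γ ^ h = Real.exp (L * h) := Real.rpow_def_of_pos hγ0 h
  have hgN : Real.exp (L * (N * h)) = Real.exp (L * h) ^ N := by
    rw [← Real.exp_nat_mul]; ring_nf
  have hLh0 : 0 ≤ -(L * h) := by nlinarith
  rw [Real.rpow_def_of_pos hγ0] at hN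
  have htail := hC (N * h) h (by positivity) hh hN
  have hsum := abs_discountedSum_sub_le (q := Real.exp (2 * a * h)) (Real.exp_pos (L * h)).le
    (Real.exp_le_one_iff.2 (by linarith)) (Real.exp_pos _).le
    (Real.exp_le_one_iff.2 (by nlinarith)) (mul_pos hc0 hh)
    (neg_log_half_mul_le_one_sub_exp hLh0 hLh) N
  have hv0 := langevinVar_nonneg a σ hh.le
  have hv1 := langevinVar_le ha σ hh.le
  have hlim := riemannMean_limit_eq (σ := σ) ha hL hh
  have h1 : |riemannMean a γ σ h N - h * langevinVar a σ h * (Real.exp (L * h)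
        / ((1 - Real.exp (L * h)) * (1 - Real.exp (L * h) * Real.exp (2 * a * h))))|
      ≤ σ ^ 2 * (1 / c + 1 / c ^ 2) * C * h ^ 3 := by
    rw [riemannMean, hg, ← mul_sub, abs_mul, abs_of_nonneg (mul_nonneg hh.le hv0)]
    calc _ ≤ (h * (σ ^ 2 * h)) * (Real.exp (L * h) ^ N * ((N + 1 / (c * h)) / (c * h))) := by
          gcongr
      _ = σ ^ 2 * (Real.exp (L * (N * h)) * ((N * h) / c + 1 / c ^ 2)) := by
          rw [hgN]; field_simp
      _ ≤ σ ^ 2 * (Real.exp (L * (N * h)) * ((1 / c + 1 / c ^ 2) * (1 + N * h) ^ 3)) := by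
          have hT : (0 : ℝ) ≤ N * h := by positivity
          have e1 := pow_le_one_add_cube hT (k := 1) (by norm_num)
          have e2 := pow_le_one_add_cube hT (k := 0) (by norm_num)
          rw [pow_one] at e1
          rw [pow_zero] at e2
          gcongr
          rw [add_mul, div_mul_eq_mul_div, div_mul_eq_mul_div, one_mul]
          gcongr
      _ = σ ^ 2 * (1 / c + 1 / c ^ 2) * (Real.exp (L * (N * h)) * (1 + N * h) ^ 3) := by ring
      _ ≤ σ ^ 2 * (1 / c + 1 / c ^ 2) * (C * h ^ 3) := by gcongr
      _ = _ := by ring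
  have h2 : |h * langevinVar a σ h * (Real.exp (L * h)
        / ((1 - Real.exp (L * h)) * (1 - Real.exp (L * h) * Real.exp (2 * a * h))))
      - V + σ ^ 2 / 12 * h ^ 2| ≤ |V| * K₁ * h ^ 3 := by
    have e1 : σ ^ 2 / 12 = V * (((L / 2) ^ 2 + (L / 2 + a) ^ 2 - a ^ 2) / 6) := by
      rw [hV]; field_simp; ring
    rw [hlim, ← hV, e1]
    have e2 : ∀ p k : ℝ, V * p - V + V * k * h ^ 2 = V * (p - (1 - k * h ^ 2)) := fun p k => by ring
    rw [e2, abs_mul, mul_assoc]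
    gcongr
    refine hb.trans ?_
    rw [Real.norm_of_nonneg (by positivity)]
    gcongr _ * ?_
    exact pow_le_pow_of_le_one hh.le hh1 (by norm_num)
  calc _ = |(riemannMean a γ σ h N - h * langevinVar a σ h * (Real.exp (L * h)
        / ((1 - Real.exp (L * h)) * (1 - Real.exp (L * h) * Real.exp (2 * a * h)))))
        + (h * langevinVar a σ h * (Real.exp (L * h)
        / ((1 - Real.exp (L * h)) * (1 - Real.exp (L * h) * Real.exp (2 * a * h))))
      - V + σ ^ 2 / 12 * h ^ 2)| := by congr 1; ring
    _ ≤ _ := (abs_add_le _ _).trans (add_le_add h1 h2)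
    _ = _ := by ring

/-- The variance of the Riemann sum estimator is `σ⁴ C(a, γ)` up to `O(h²)`, once the horizon is so
long that `γ^T ≤ h⁴`. -/
lemma exists_riemannVar_sub_le {a γ : ℝ} (ha : a ≤ 0) (hγ0 : 0 < γ) (hγ1 : γ < 1) (σ : ℝ) :
    ∃ K : ℝ, 0 ≤ K ∧ ∀ᶠ h in 𝓝[>] (0 : ℝ), ∀ N : ℕ, γ ^ ((N : ℝ) * h) ≤ h ^ 4 →
      |riemannVar a γ σ h N - σ ^ 4 * varianceConst a γ| ≤ K * h ^ 2 := by
  set L := Real.log γ with hLdef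
  have hL : L < 0 := Real.log_neg hγ0 hγ1
  have hL0 := hL.ne
  obtain ⟨C, hC0, hC⟩ := exists_exp_mul_cubic_le hL
  obtain ⟨K₁, hK₁, hexp⟩ := (isBigO_varianceFactor_sub_one a (a + L) (L / 2 + a) L).exists_pos
  set c := -L / 2 with hc
  have hc0 : 0 < c := by rw [hc]; linarith
  set V := σ ^ 4 * varianceConst a γ with hV
  set D := 1 / c ^ 2 + 2 / c ^ 3 + 3 / c ^ 4 + 2 / c with hD
  have hD0 : 0 ≤ D := by positivity
  refine ⟨2 * σ ^ 4 * D * C + |V| * K₁, by positivity, ?_⟩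
  filter_upwards [eventually_small_step L, nhdsWithin_le_nhds hexp.bound]
    with h ⟨hh, hh1, hLh⟩ hb N hN
  have hg : γ ^ h = Real.exp (L * h) := Real.rpow_def_of_pos hγ0 h
  have hgN : Real.exp (L * (N * h)) = Real.exp (L * h) ^ N := by
    rw [← Real.exp_nat_mul]; ring_nf
  have hLh0 : 0 ≤ -(L * h) := by nlinarith
  rw [Real.rpow_def_of_pos hγ0] at hN
  have htail := hC (N * h) h (by positivity) hh hN
  have hsum := abs_discountedSqSum_sub_le (q := Real.exp (2 * a * h)) (Real.exp_pos (L * h)).le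
    (Real.exp_le_one_iff.2 (by linarith)) (Real.exp_pos _).le
    (Real.exp_le_one_iff.2 (by nlinarith)) (mul_pos hc0 hh)
    (neg_log_half_mul_le_one_sub_exp hLh0 hLh) N
  have hv0 := langevinVar_nonneg a σ hh.le
  have hv1 := langevinVar_le ha σ hh.le
  have hlim := riemannVar_limit_eq (σ := σ) ha hL hh
  set S := Real.exp (L * h) ^ 2 * (1 + Real.exp (L * h) ^ 2 * Real.exp (2 * a * h))
    / ((1 - Real.exp (L * h) * Real.exp (2 * a * h)) ^ 2 * (1 - Real.exp (L * h) ^ 2)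
      * (1 - Real.exp (L * h) ^ 2 * Real.exp (2 * a * h))) with hS
  have h1 : |riemannVar a γ σ h N - 2 * h ^ 2 * langevinVar a σ h ^ 2 * S|
      ≤ 2 * σ ^ 4 * D * C * h ^ 2 := by
    rw [riemannVar, hg, ← mul_sub, abs_mul, abs_of_nonneg (by positivity)]
    calc _ ≤ (2 * h ^ 2 * (σ ^ 2 * h) ^ 2) * (Real.exp (L * h) ^ N
            * (N ^ 2 / (c * h) ^ 2 + 2 * N / (c * h) ^ 3 + 3 / (c * h) ^ 4
              + 2 * N ^ 3 / (c * h))) := by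
          gcongr
      _ = 2 * σ ^ 4 * (Real.exp (L * (N * h)) * (1 / c ^ 2 * (N * h) ^ 2 + 2 / c ^ 3 * (N * h)
            + 3 / c ^ 4 * 1 + 2 / c * (N * h) ^ 3)) := by
          rw [hgN]; field_simp
      _ ≤ 2 * σ ^ 4 * (Real.exp (L * (N * h)) * (D * (1 + N * h) ^ 3)) := by
          have hT : (0 : ℝ) ≤ N * h := by positivity
          have e1 := pow_le_one_add_cube hT (k := 1) (by norm_num)
          have e2 := pow_le_one_add_cube hT (k := 0) (by norm_num)
          have e3 := pow_le_one_add_cube hT (k := 2) (by norm_num)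
          have e4 := pow_le_one_add_cube hT (k := 3) le_rfl
          rw [pow_one] at e1
          rw [pow_zero] at e2
          rw [hD, add_mul, add_mul, add_mul]
          gcongr
      _ = 2 * σ ^ 4 * D * (Real.exp (L * (N * h)) * (1 + N * h) ^ 3) := by ring
      _ ≤ 2 * σ ^ 4 * D * (C * h ^ 3) := by gcongr
      _ ≤ 2 * σ ^ 4 * D * (C * h ^ 2) := by
          gcongr _ * (_ * ?_)
          exact pow_le_pow_of_le_one hh.le hh1 (by norm_num)
      _ = _ := by ring
  have h2 : |2 * h ^ 2 * langevinVar a σ h ^ 2 * S - V| ≤ |V| * K₁ * h ^ 2 := by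
    rw [hlim, show σ ^ 4 * (1 / (L * (a + L) * (2 * a + L) ^ 2)) = V from rfl, ← mul_sub_one,
      abs_mul, mul_assoc]
    gcongr
    refine hb.trans ?_
    rw [Real.norm_of_nonneg (by positivity)]
  calc _ = |(riemannVar a γ σ h N - 2 * h ^ 2 * langevinVar a σ h ^ 2 * S)
        + (2 * h ^ 2 * langevinVar a σ h ^ 2 * S - V)| := by congr 1; ring
    _ ≤ _ := (abs_add_le _ _).trans (add_le_add h1 h2)
    _ = _ := by ring

/-! ### The optimal step size -/

lemma varianceConst_pos {a γ : ℝ} (ha : a ≤ 0) (hγ0 : 0 < γ) (hγ1 : γ < 1) :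
    0 < varianceConst a γ := by
  have hL := Real.log_neg hγ0 hγ1
  have h1 : 0 < Real.log γ * (a + Real.log γ) := mul_pos_of_neg_of_neg hL (by linarith)
  have h2 : 2 * a + Real.log γ ≠ 0 := by linarith
  exact one_div_pos.2 (mul_pos h1 (by positivity))

lemma optimalStep_pos {a γ T B : ℝ} (hC : 0 < varianceConst a γ) (hT : 0 < T) (hB : 0 < B) :
    0 < optimalStep a γ T B :=
  Real.rpow_pos_of_pos (by positivity) _

lemma leadingMSE_eq {a γ T B : ℝ} (hC : 0 < varianceConst a γ) (hT : 0 < T) (hB : 0 < B)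
    (σ : ℝ) {h : ℝ} (hh : h ≠ 0) :
    leadingMSE a γ σ T B h = σ ^ 4 / 144 * (4 * optimalStep a γ T B ^ 5 / h + h ^ 4) := by
  have h5 : optimalStep a γ T B ^ 5 = 36 * T * varianceConst a γ / B := by
    rw [optimalStep, ← Real.rpow_natCast, ← Real.rpow_mul (by positivity)]
    norm_num
  rw [h5, leadingMSE]
  field_simp
  ring

lemma leadingMSE_optimalStep_lt {a γ σ T B : ℝ} (hC : 0 < varianceConst a γ) (hσ : 0 < σ)
    (hT : 0 < T) (hB : 0 < B) {h : ℝ} (hh : 0 < h) (hne : h ≠ optimalStep a γ T B) :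
    leadingMSE a γ σ T B (optimalStep a γ T B) < leadingMSE a γ σ T B h := by
  have hs := optimalStep_pos hC hT hB
  rw [leadingMSE_eq hC hT hB σ hs.ne', leadingMSE_eq hC hT hB σ hh.ne']
  set s := optimalStep a γ T B
  have h1 : 4 * s ^ 5 / h + h ^ 4 - (4 * s ^ 5 / s + s ^ 4)
      = (h - s) ^ 2 * (h ^ 3 + 2 * h ^ 2 * s + 3 * h * s ^ 2 + 4 * s ^ 3) / h := by
    field_simp
    ring
  have h2 : 0 < (h - s) ^ 2 := by
    have := sub_ne_zero.2 hne
    positivity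
  have h3 : 0 < (h - s) ^ 2 * (h ^ 3 + 2 * h ^ 2 * s + 3 * h * s ^ 2 + 4 * s ^ 3) / h := by
    positivity
  gcongr ?_ * ?_
  linarith

lemma leadingMSE_pos {a γ σ T B : ℝ} (hC : 0 < varianceConst a γ) (hσ : 0 < σ) (hT : 0 < T)
    (hB : 0 < B) {h : ℝ} (hh : 0 < h) : 0 < leadingMSE a γ σ T B h := by
  unfold leadingMSE
  positivity

lemma leadingMSE_div_optimal {a γ σ T B : ℝ} (hC : 0 < varianceConst a γ) (hσ : 0 < σ)
    (hT : 0 < T) (hB : 0 < B) {h : ℝ} (hh : 0 < h) :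
    leadingMSE a γ σ T B h / leadingMSE a γ σ T B (optimalStep a γ T B)
      = (4 / (h / optimalStep a γ T B) + (h / optimalStep a γ T B) ^ 4) / 5 := by
  have hs := optimalStep_pos hC hT hB
  rw [leadingMSE_eq hC hT hB σ hs.ne', leadingMSE_eq hC hT hB σ hh.ne']
  field_simp
  ring

/-- The ratio `(4 / ρ + ρ⁴) / 5` of the leading parts exceeds `1` by at least `3 (ρ - 1)² / 5`. -/
lemma tendsto_leading_ratio_iff {ι : Type*} {l : Filter ι} {ρ : ι → ℝ} (hρ : ∀ j, 0 < ρ j) :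
    Tendsto (fun j => (4 / ρ j + ρ j ^ 4) / 5) l (𝓝 1) ↔ Tendsto ρ l (𝓝 1) := by
  constructor
  · intro h
    have h1 : ∀ j, (ρ j - 1) ^ 2 ≤ 5 / 3 * ((4 / ρ j + ρ j ^ 4) / 5 - 1) := by
      intro j
      have hj := hρ j
      have e : 5 / 3 * ((4 / ρ j + ρ j ^ 4) / 5 - 1) - (ρ j - 1) ^ 2
          = (ρ j - 1) ^ 2 * (ρ j ^ 3 + 2 * ρ j ^ 2 + 4) / (3 * ρ j) := by
        field_simp
        ring
      have : 0 ≤ (ρ j - 1) ^ 2 * (ρ j ^ 3 + 2 * ρ j ^ 2 + 4) / (3 * ρ j) := by positivity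
      linarith
    have h2 : Tendsto (fun j => 5 / 3 * ((4 / ρ j + ρ j ^ 4) / 5 - 1)) l (𝓝 0) := by
      simpa using (h.sub_const 1).const_mul (5 / 3)
    have h3 : Tendsto (fun j => (ρ j - 1) ^ 2) l (𝓝 0) :=
      squeeze_zero (fun _ => sq_nonneg _) h1 h2
    have h4 : Tendsto (fun j => |ρ j - 1|) l (𝓝 0) := by
      simpa [Real.sqrt_sq_eq_abs] using h3.sqrt
    have h5 := ((tendsto_zero_iff_abs_tendsto_zero _).2 h4).add_const 1
    simpa using h5
  · intro h
    have h1 : Tendsto (fun j => 4 / ρ j) l (𝓝 (4 / 1)) := tendsto_const_nhds.div h one_ne_zero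
    have h2 := (h1.add (h.pow 4)).div_const 5
    norm_num at h2
    exact h2

theorem isEquivalent_leadingMSE_iff {ι : Type*} {l : Filter ι} {a γ σ : ℝ}
    (hC : 0 < varianceConst a γ) (hσ : 0 < σ) {h T B : ι → ℝ} (hh : ∀ j, 0 < h j)
    (hT : ∀ j, 0 < T j) (hB : ∀ j, 0 < B j) :
    ((fun j => leadingMSE a γ σ (T j) (B j) (h j)) ~[l]
        fun j => leadingMSE a γ σ (T j) (B j) (optimalStep a γ (T j) (B j))) ↔
      h ~[l] fun j => optimalStep a γ (T j) (B j) := by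
  have hs := fun j => optimalStep_pos hC (hT j) (hB j)
  rw [isEquivalent_iff_tendsto_one (Eventually.of_forall fun j =>
      (leadingMSE_pos hC hσ (hT j) (hB j) (hs j)).ne'),
    isEquivalent_iff_tendsto_one (Eventually.of_forall fun j => (hs j).ne')]
  refine Iff.trans (tendsto_congr fun j => ?_)
    (tendsto_leading_ratio_iff fun j => div_pos (hh j) (hs j))
  exact leadingMSE_div_optimal hC hσ (hT j) (hB j) (hh j)

/-! ### The mean-squared error -/

/-- Expansion of the squared bias, `σ⁴ h⁴ / 144 + O(h⁵)`, and of the variance of one trajectory,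
`σ⁴ C(a, γ) + O(h²)`, with constants uniform in the number of samples. -/
lemma exists_mse_expansion {a γ : ℝ} (ha : a ≤ 0) (hγ0 : 0 < γ) (hγ1 : γ < 1) (σ : ℝ) :
    ∃ K : ℝ, 0 ≤ K ∧ ∀ᶠ h in 𝓝[>] (0 : ℝ), ∀ N : ℕ, γ ^ ((N : ℝ) * h) ≤ h ^ 4 →
      |(riemannMean a γ σ h N - σ ^ 2 / (Real.log γ * (Real.log γ + 2 * a))) ^ 2
        - σ ^ 4 / 144 * h ^ 4| ≤ K * h ^ 5 ∧
      |riemannVar a γ σ h N - σ ^ 4 * varianceConst a γ| ≤ K * h ^ 2 := by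
  obtain ⟨K₁, hK₁, h₁⟩ := exists_riemannMean_sub_le ha hγ0 hγ1 σ
  obtain ⟨K₂, hK₂, h₂⟩ := exists_riemannVar_sub_le ha hγ0 hγ1 σ
  refine ⟨K₁ ^ 2 + σ ^ 2 / 6 * K₁ + K₂, by positivity, ?_⟩
  filter_upwards [h₁, h₂, eventually_small_step 0] with h e₁ e₂ ⟨hh, hh1, _⟩ N hN
  have e₁ := e₁ N hN
  have e₂ := e₂ N hN
  set b := riemannMean a γ σ h N - σ ^ 2 / (Real.log γ * (Real.log γ + 2 * a))
  set e := b + σ ^ 2 / 12 * h ^ 2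
  constructor
  · have h1 : b ^ 2 - σ ^ 4 / 144 * h ^ 4 = e ^ 2 - σ ^ 2 / 6 * h ^ 2 * e := by ring
    have h2 : h ^ 6 ≤ h ^ 5 := pow_le_pow_of_le_one hh.le hh1 (by norm_num)
    rw [h1]
    calc |e ^ 2 - σ ^ 2 / 6 * h ^ 2 * e| ≤ |e ^ 2| + |σ ^ 2 / 6 * h ^ 2 * e| := abs_sub _ _
      _ = |e| ^ 2 + σ ^ 2 / 6 * h ^ 2 * |e| := by
        rw [abs_pow, abs_mul, abs_of_nonneg (by positivity : 0 ≤ σ ^ 2 / 6 * h ^ 2)]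
      _ ≤ (K₁ * h ^ 3) ^ 2 + σ ^ 2 / 6 * h ^ 2 * (K₁ * h ^ 3) := by gcongr
      _ = K₁ ^ 2 * h ^ 6 + σ ^ 2 / 6 * K₁ * h ^ 5 := by ring
      _ ≤ K₁ ^ 2 * h ^ 5 + σ ^ 2 / 6 * K₁ * h ^ 5 + K₂ * h ^ 5 := by
        have := mul_le_mul_of_nonneg_left h2 (sq_nonneg K₁)
        have : 0 ≤ K₂ * h ^ 5 := by positivity
        linarith
      _ = _ := by ring
  · refine e₂.trans ?_
    gcongr
    have : 0 ≤ K₁ ^ 2 + σ ^ 2 / 6 * K₁ := by positivity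
    linarith

theorem mainTheorem2 (a γ σ : ℝ) (ha : a ≤ 0) (hγ0 : 0 < γ) (hγ1 : γ < 1) (hσ : 0 < σ) :
    -- the leading part is minimised over all step sizes exactly at the optimal step
    (∀ T B : ℝ, 0 < T → 0 < B → 0 < optimalStep a γ T B ∧
      ∀ h : ℝ, 0 < h → h ≠ optimalStep a γ T B →
        leadingMSE a γ σ T B (optimalStep a γ T B) < leadingMSE a γ σ T B h) ∧
    -- the implied constant `K` depends on `a`, `γ`, `σ` only
    ∃ K : ℝ,
      ∀ (Ω : Type*) [MeasurableSpace Ω] (μ : Measure Ω) [IsProbabilityMeasure μ]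
        (w x : ℕ → ℝ≥0 → Ω → ℝ),
        (∀ i, IsLangevinSolution μ a σ (w i) (x i)) →
        iIndepFun (fun (i : ℕ) (ω : Ω) (t : ℝ≥0) => x i t ω) μ →
        -- the expectations below exist
        (∀ i, Integrable (fun p : ℝ × Ω => γ ^ p.1 * x i p.1.toNNReal p.2 ^ 2)
          ((volume.restrict (Set.Ioi (0 : ℝ))).prod μ)) ∧
        (∀ (h : ℝ) (N M : ℕ), 0 < h → MemLp (monteCarloEstimator γ h N M x) 2 μ) ∧
        -- families of step sizes `h`, with `T = N h` and `B = M N`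
        ∀ (ι : Type*) (l : Filter ι) (h : ι → ℝ) (N M : ι → ℕ) (T B : ι → ℝ),
          (∀ j, 0 < h j) → (∀ j, 0 < N j) → (∀ j, 0 < M j) →
          (∀ j, T j = N j * h j) → (∀ j, B j = M j * N j) →
          Tendsto h l (𝓝 0) →
          (fun j => γ ^ T j) =o[l] (fun j => h j ^ 4) →
          (∃ R₁ R₂ : ι → ℝ,
            (∀ j, mseInfinite μ γ (h j) (N j) (M j) x =
              σ ^ 4 * T j * varianceConst a γ * (1 / (h j * B j)) + σ ^ 4 / 144 * h j ^ 4
                + R₁ j + R₂ j) ∧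
            IsBigOWith K l R₁ (fun j => h j ^ 5) ∧
            IsBigOWith K l R₂ (fun j => h j * T j / B j) ∧
            ((fun j => h j * T j) =O[l] (fun _ => (1 : ℝ)) → R₂ =O[l] (fun j => (B j)⁻¹))) ∧
          -- asymptotic optimality of the step `h*`
          (∀ ε : ℝ, 0 < ε → ∀ᶠ j in l,
            (1 - ε) * leadingMSE a γ σ (T j) (B j) (optimalStep a γ (T j) (B j)) ≤
              mseInfinite μ γ (h j) (N j) (M j) x) ∧
          ((fun j => mseInfinite μ γ (h j) (N j) (M j) x) ~[l]
              (fun j => leadingMSE a γ σ (T j) (B j) (optimalStep a γ (T j) (B j))) ↔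
            h ~[l] (fun j => optimalStep a γ (T j) (B j))) := by
  have hC := varianceConst_pos ha hγ0 hγ1
  refine ⟨fun T B hT hB => ⟨optimalStep_pos hC hT hB, fun h hh hne =>
    leadingMSE_optimalStep_lt hC hσ hT hB hh hne⟩, ?_⟩
  obtain ⟨K, hK, hexp⟩ := exists_mse_expansion ha hγ0 hγ1 σ
  refine ⟨K, fun Ω _ μ _ w x hx hind => ⟨fun i => (hx i).integrable_discounted ha hγ0 hγ1,
    fun h N M _ => memLp_monteCarloEstimator hx ha γ h N M, ?_⟩⟩
  intro ι l h N M T B hh hN hM hTN hBN hlim hγT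
  have hM0 : ∀ j, (0 : ℝ) < M j := fun j => by exact_mod_cast hM j
  have hN0 : ∀ j, (0 : ℝ) < N j := fun j => by exact_mod_cast hN j
  have hT0 : ∀ j, 0 < T j := fun j => by rw [hTN]; exact mul_pos (hN0 j) (hh j)
  have hB0 : ∀ j, 0 < B j := fun j => by rw [hBN]; exact mul_pos (hM0 j) (hN0 j)
  have hs := fun j => optimalStep_pos hC (hT0 j) (hB0 j)
  set V := σ ^ 2 / (Real.log γ * (Real.log γ + 2 * a)) with hV
  set R₁ : ι → ℝ := fun j => (riemannMean a γ σ (h j) (N j) - V) ^ 2 - σ ^ 4 / 144 * h j ^ 4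
    with hR₁
  set R₂ : ι → ℝ := fun j => (riemannVar a γ σ (h j) (N j) - σ ^ 4 * varianceConst a γ) / M j
    with hR₂
  have hvarterm : ∀ j, σ ^ 4 * T j * varianceConst a γ * (1 / (h j * B j))
      = σ ^ 4 * varianceConst a γ / M j := by
    intro j
    have := hh j
    have := hM0 j
    have := hN0 j
    rw [hTN, hBN]
    field_simp
  have hratio : ∀ j, h j * T j / B j = h j ^ 2 / M j := by
    intro j
    have := hM0 j
    have := hN0 j
    rw [hTN, hBN]
    field_simp
  have hmse : ∀ j, mseInfinite μ γ (h j) (N j) (M j) x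
      = leadingMSE a γ σ (T j) (B j) (h j) + R₁ j + R₂ j := by
    intro j
    rw [mseInfinite_eq hx ha hind hγ0 (hh j) (N j) (hM j), (hx 0).expectedCost_eq ha hγ0 hγ1,
      leadingMSE, hvarterm, hR₁, hR₂]
    ring
  have hlim' : Tendsto h l (𝓝[>] 0) :=
    tendsto_nhdsWithin_iff.2 ⟨hlim, Eventually.of_forall hh⟩
  have hev : ∀ᶠ j in l, |R₁ j| ≤ K * h j ^ 5 ∧ |R₂ j| ≤ K * (h j ^ 2 / M j) := by
    filter_upwards [hlim'.eventually hexp, hγT.bound one_pos] with j hj hj'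
    rw [one_mul, Real.norm_of_nonneg (Real.rpow_nonneg hγ0.le _),
      Real.norm_of_nonneg (pow_nonneg (hh j).le 4), hTN] at hj'
    obtain ⟨e₁, e₂⟩ := hj (N j) hj'
    refine ⟨e₁, ?_⟩
    rw [hR₂, abs_div, abs_of_pos (hM0 j), ← mul_div_assoc]
    exact div_le_div_of_nonneg_right e₂ (hM0 j).le
  have hO₁ : IsBigOWith K l R₁ fun j => h j ^ 5 := by
    refine IsBigOWith.of_bound (hev.mono fun j hj => ?_)
    rw [Real.norm_eq_abs, Real.norm_of_nonneg (pow_nonneg (hh j).le 5)]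
    exact hj.1
  have hO₂ : IsBigOWith K l R₂ fun j => h j * T j / B j := by
    refine IsBigOWith.of_bound (hev.mono fun j hj => ?_)
    rw [hratio, Real.norm_eq_abs,
      Real.norm_of_nonneg (div_nonneg (sq_nonneg _) (hM0 j).le)]
    exact hj.2
  -- relative to the leading part `F`, the remainders are `O(h)`: `h⁵ ≤ (144 / σ⁴) h F`, and
  -- `h² / M ≤ h F / (σ⁴ C)` for `h ≤ 1`
  set K' := K * (144 / σ ^ 4) + K / (σ ^ 4 * varianceConst a γ) with hK'
  have hrel : ∀ᶠ j in l, |R₁ j + R₂ j| ≤ K' * h j * leadingMSE a γ σ (T j) (B j) (h j) := by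
    filter_upwards [hev, hlim.eventually_le_const one_pos] with j hj hj1
    have h0 := hh j
    have h1 := hM0 j
    refine (abs_add_le _ _).trans ((add_le_add hj.1 hj.2).trans ?_)
    rw [leadingMSE, hvarterm, hK', ← sub_nonneg]
    have e : (K * (144 / σ ^ 4) + K / (σ ^ 4 * varianceConst a γ)) * h j
          * (σ ^ 4 * varianceConst a γ / M j + σ ^ 4 / 144 * h j ^ 4)
          - (K * h j ^ 5 + K * (h j ^ 2 / M j))
        = K * (144 / σ ^ 4) * h j * (σ ^ 4 * varianceConst a γ / M j)
          + K / M j * h j * (1 - h j)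
          + K / (σ ^ 4 * varianceConst a γ) * h j * (σ ^ 4 / 144 * h j ^ 4) := by
      field_simp
      ring
    have h2 : 0 ≤ 1 - h j := sub_nonneg.2 hj1
    rw [e]
    positivity
  have hequiv : (fun j => mseInfinite μ γ (h j) (N j) (M j) x) ~[l]
      fun j => leadingMSE a γ σ (T j) (B j) (h j) := by
    have h1 : Tendsto (fun j => K' * h j) l (𝓝 0) := by simpa using hlim.const_mul K'
    refine IsLittleO.of_bound fun c hc => ?_
    filter_upwards [hrel, h1.eventually_le_const hc] with j hj hj'
    have h2 := leadingMSE_pos hC hσ (hT0 j) (hB0 j) (hh j)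
    rw [Pi.sub_apply, hmse, add_assoc, add_sub_cancel_left, Real.norm_eq_abs,
      Real.norm_of_nonneg h2.le]
    exact hj.trans (mul_le_mul_of_nonneg_right hj' h2.le)
  refine ⟨⟨R₁, R₂, hmse, hO₁, hO₂, fun hbd => ?_⟩, fun ε hε => ?_, ?_⟩
  · refine hO₂.isBigO.trans ?_
    simpa [div_eq_mul_inv] using hbd.mul (isBigO_refl (fun j => (B j)⁻¹) l)
  · have h1 : Tendsto (fun j => K' * h j) l (𝓝 0) := by simpa using hlim.const_mul K'
    filter_upwards [hrel, h1.eventually_le_const hε] with j hj hj'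
    have hF := leadingMSE_pos hC hσ (hT0 j) (hB0 j) (hh j)
    have hFs := leadingMSE_pos hC hσ (hT0 j) (hB0 j) (hs j)
    rcases le_or_gt ε 1 with hε1 | hε1
    · have h2 : leadingMSE a γ σ (T j) (B j) (optimalStep a γ (T j) (B j))
          ≤ leadingMSE a γ σ (T j) (B j) (h j) := by
        rcases eq_or_ne (h j) (optimalStep a γ (T j) (B j)) with he | he
        · rw [← he]
        · exact (leadingMSE_optimalStep_lt hC hσ (hT0 j) (hB0 j) (hh j) he).le
      have h3 := hj.trans (mul_le_mul_of_nonneg_right hj' hF.le)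
      have h4 := mul_le_mul_of_nonneg_left h2 (sub_nonneg.2 hε1)
      rw [hmse]
      linarith [(abs_le.1 h3).1]
    · have h2 : 0 ≤ mseInfinite μ γ (h j) (N j) (M j) x := integral_nonneg fun _ => sq_nonneg _
      have h3 : (1 - ε) * leadingMSE a γ σ (T j) (B j) (optimalStep a γ (T j) (B j)) ≤ 0 :=
        mul_nonpos_of_nonpos_of_nonneg (by linarith) hFs.le
      exact h3.trans h2
  · rw [← isEquivalent_leadingMSE_iff hC hσ hh hT0 hB0]
    exact ⟨fun h1 => hequiv.symm.trans h1, fun h1 => hequiv.trans h1⟩
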